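/- Let $G$ be a locally compact Hausdorff group with a fixed (regular) left Haar measure, let $L^1(G)$ be its group algebra with the convolution product $(\phi*\psi)(y)=\int_G\phi(x)\psi(x^{-1}y)\,dx$, and let $M(G)$ be the space of regular complex Borel measures on $G$ with the total variation norm. For $\mu\in M(G)$ and $\phi\in L^1(G)$ let $\mu*\phi\in L^1(G)$ be the convolution $(\mu*\phi)(y)=\int_G\phi(x^{-1}y)\,d\mu(x)$. Let $\alpha:L^1(G)\to L^1(G)$ be a continuous surjective algebra homomorphism. A map $T:L^1(G)\to L^1(G)$ is called a Jordan left $\alpha$-centralizer if it is additive and $T(a*a)=T(a)*\alpha(a)$ for all $a\in L^1(G)$. Then every continuous Jordan left $\alpha$-centralizer on $L^1(G)$ is $\mathbb{C}$-linear; the set $\mathrm{JL}^c_\alpha(L^1(G))$ of all continuous Jordan left $\alpha$-centralizers is a Banach space under the operator norm; and for each $\mu\in M(G)$ the map $\Lambda_{\mu,\alpha}:\phi\mapsto\mu*\alpha(\phi)$ belongs to $\mathrm{JL}^c_\alpha(L^1(G))$, and the map $$\Gamma:M(G)\to \mathrm{JL}^c_\alpha(L^1(G)),\qquad \Gamma(\mu)=\Lambda_{\mu,\alpha},$$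 is a homeomorphism of $M(G)$ onto $\mathrm{JL}^c_\alpha(L^1(G))$ for the norm topologies. -/

import Mathlib

open MeasureTheory Topology
open scoped ENNReal ZeroAtInfty

noncomputable section

namespace GroupAlgebra

/-- A measure dominated by a finite regular measure is regular. -/
theorem regular_of_le {X : Type*} [TopologicalSpace X] [MeasurableSpace X] [BorelSpace X]
    [T2Space X] {ρ σ : Measure X} [IsFiniteMeasure σ] [σ.InnerRegular] (h : ρ ≤ σ) :
    ρ.Regular := by
  have : IsFiniteMeasure ρ := isFiniteMeasure_of_le σ h
  have : ρ.InnerRegular := by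
    refine ⟨fun A hA r hr => ?_⟩
    obtain ⟨K, hKA, hK, hlt⟩ := hA.exists_isCompact_sdiff_lt (μ := σ) (measure_ne_top _ _)
      (ε := ρ A - r) (tsub_pos_of_lt hr).ne'
    refine ⟨K, hKA, hK, ?_⟩
    have h1 : ρ A ≤ ρ K + ρ (A \ K) := by
      rw [← measure_sdiff_add_inter A hK.measurableSet, add_comm]
      gcongr
      exact Set.inter_subset_right
    have h2 : ρ (A \ K) < ρ A - r := (h _).trans_lt hlt
    by_contra hc
    push Not at hc
    have h3 : ρ A < r + (ρ A - r) := h1.trans_lt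
      (ENNReal.add_lt_add_of_le_of_lt (ne_top_of_le_ne_top (ne_top_of_lt hr) hc) hc h2)
    rw [add_tsub_cancel_of_le hr.le] at h3
    exact lt_irrefl _ h3
  infer_instance

/-- A continuous vector-valued function is strongly measurable with respect to a finite measure
that is inner regular for compact sets. -/
theorem aestronglyMeasurable_of_continuous_of_finite {X E : Type*} [TopologicalSpace X]
    [T2Space X] [MeasurableSpace X] [BorelSpace X] [NormedAddCommGroup E]
    {m : Measure X} [IsFiniteMeasure m] [m.InnerRegularCompactLTTop] {F : X → E}
    (hF : Continuous F) : AEStronglyMeasurable F m := by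
  choose K _ hK hlt using fun n : ℕ =>
    (MeasurableSet.univ (α := X)).exists_isCompact_sdiff_lt (μ := m) (measure_ne_top _ _)
      (ε := (n + 1 : ℝ≥0∞)⁻¹) (by simp)
  have hnull : m (⋃ n, K n)ᶜ = 0 := by
    refine le_antisymm (ge_of_tendsto' (x := Filter.atTop)
      (f := fun n : ℕ => (n + 1 : ℝ≥0∞)⁻¹) ?_ fun n => ?_) zero_le
    · have := (Filter.tendsto_add_atTop_iff_nat 1).2 ENNReal.tendsto_inv_nat_nhds_zero
      simpa using this
    · refine (measure_mono ?_).trans (hlt n).le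
      rw [← Set.compl_eq_univ_sdiff]
      exact Set.compl_subset_compl.2 (Set.subset_iUnion K n)
  have h := (aestronglyMeasurable_iUnion_iff (μ := m) (f := F) (s := K)).2
    fun n => hF.continuousOn.aestronglyMeasurable_of_isCompact (hK n) (hK n).measurableSet
  rwa [Measure.restrict_eq_self_of_ae_mem] at h
  exact mem_ae_iff.2 hnull

/-- For a regular Borel measure `m` on a Hausdorff space, an integrable scalar
function times a bounded continuous vector-valued function is integrable. -/
theorem integrable_smul_continuous {X E 𝕜 : Type*} [RCLike 𝕜] [TopologicalSpace X] [T2Space X]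
    [MeasurableSpace X] [BorelSpace X] [NormedAddCommGroup E] [NormedSpace 𝕜 E]
    {m : Measure X} [m.Regular] {g : X → 𝕜} (hg : Integrable g m) {F : X → E}
    (hF : Continuous F) {C : ℝ} (hC : ∀ x, ‖F x‖ ≤ C) :
    Integrable (fun x => g x • F x) m := by
  have hmeas : AEStronglyMeasurable (fun x => g x • F x) m := by
    obtain ⟨t, ht, h0, hfin⟩ :=
      (memLp_one_iff_integrable.2 hg).aefinStronglyMeasurable (by simp) (by simp)
        |>.exists_set_sigmaFinite
    have hFt : AEStronglyMeasurable F (m.restrict t) := by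
      have h := (aestronglyMeasurable_iUnion_iff (μ := m.restrict t) (f := F)
        (s := spanningSets (m.restrict t))).2 fun n => by
          have : IsFiniteMeasure ((m.restrict t).restrict (spanningSets (m.restrict t) n)) :=
            ⟨by simpa using measure_spanningSets_lt_top (m.restrict t) n⟩
          exact aestronglyMeasurable_of_continuous_of_finite hF
      rwa [iUnion_spanningSets, Measure.restrict_univ] at h
    have h1 : AEStronglyMeasurable (fun x => g x • F x) (m.restrict t) :=
      hg.aestronglyMeasurable.restrict.smul hFt
    have h2 : AEStronglyMeasurable (fun x => g x • F x) (m.restrict tᶜ) := by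
      refine aestronglyMeasurable_zero.congr (?_ : (0 : X → E) =ᵐ[_] _)
      filter_upwards [h0] with x hx
      simp [hx]
    have h := aestronglyMeasurable_union_iff.2 ⟨h1, h2⟩
    rwa [Set.union_compl_self, Measure.restrict_univ] at h
  refine (hg.norm.mul_const C).mono' hmeas (Filter.Eventually.of_forall fun x => ?_)
  rw [norm_smul]
  gcongr
  exact hC x

section Measures

variable (G : Type*) [TopologicalSpace G] [MeasurableSpace G] [BorelSpace G] [T2Space G]

/-- The complex vector space of regular complex Borel measures: the total variation is a
finite regular measure. (Finiteness of the total variation is automatic for complex measures.) -/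
def regularComplexMeasures : Submodule ℂ (ComplexMeasure G) where
  carrier := {μ | IsFiniteMeasure μ.variation ∧ μ.variation.Regular}
  zero_mem' := by
    simp only [Set.mem_ofPred_eq, VectorMeasure.variation_zero]
    exact ⟨inferInstance, inferInstance⟩
  add_mem' := by
    rintro μ ν ⟨_, _⟩ ⟨_, _⟩
    have h := VectorMeasure.variation_add_le (μ := μ) (ν := ν)
    exact ⟨isFiniteMeasure_of_le _ h, regular_of_le h⟩
  smul_mem' := by
    rintro c μ ⟨_, _⟩
    simp only [Set.mem_ofPred_eq, VectorMeasure.variation_smul]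
    exact ⟨inferInstance, inferInstance⟩

/-- The measure algebra `M(G)`, as a space of measures. -/
abbrev MeasureAlgebra : Type _ := regularComplexMeasures G

variable {G}

instance (μ : MeasureAlgebra G) : IsFiniteMeasure μ.1.variation := μ.2.1

instance (μ : MeasureAlgebra G) : μ.1.variation.Regular := μ.2.2

/-- The total variation norm `‖μ‖ = |μ|(G)` on `M(G)`. -/
def totalVariationNorm : AddGroupNorm (MeasureAlgebra G) where
  toFun μ := μ.1.variation.real Set.univ
  map_zero' := by simp
  add_le' μ ν := by
    have h := VectorMeasure.variation_add_le (μ := μ.1) (ν := ν.1) 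
    have h2 := ENNReal.toReal_mono (measure_ne_top _ _) (h Set.univ)
    simpa [Measure.real, ENNReal.toReal_add] using h2
  neg' μ := by simp
  eq_zero_of_map_eq_zero' μ h := by
    have h0 : μ.1.variation = 0 := by
      rw [← Measure.measure_univ_eq_zero]
      simpa [Measure.real, ENNReal.toReal_eq_zero_iff] using h
    exact Subtype.ext (VectorMeasure.variation_eq_zero.1 h0)

/-- `M(G)` carries the total variation norm and the topology it defines. -/
instance : NormedAddCommGroup (MeasureAlgebra G) := totalVariationNorm.toNormedAddCommGroup

theorem norm_def (μ : MeasureAlgebra G) : ‖μ‖ = μ.1.variation.real Set.univ := rfl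

instance : NormedSpace ℂ (MeasureAlgebra G) where
  norm_smul_le c μ := by
    simp [norm_def, VectorMeasure.variation_smul, Measure.real]

end Measures


section L1

set_option linter.unusedSectionVars false

variable {G : Type*} [Group G] [TopologicalSpace G] [IsTopologicalGroup G] [LocallyCompactSpace G]
  [T2Space G] [MeasurableSpace G] [BorelSpace G]
  (lam : Measure G) [lam.IsHaarMeasure] [lam.Regular]

/-- The space `L¹(G)` of complex functions (mod null functions) integrable with respect to the
left Haar measure `lam`, with the `L¹`-norm. -/
abbrev L1 : Type _ := Lp ℂ 1 lam

variable {lam}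

/-- Left translation on `L¹(G)`: `(translate x φ)(y) = φ (x⁻¹ y)`. -/
def translate (x : G) (φ : L1 lam) : L1 lam := DomMulAct.mk x⁻¹ • φ

theorem translate_ae (x : G) (φ : L1 lam) :
    ∀ᵐ y ∂lam, translate x φ y = φ (x⁻¹ * y) :=
  DomMulAct.smul_Lp_ae_eq (DomMulAct.mk x⁻¹) φ

theorem continuous_translate (φ : L1 lam) : Continuous fun x : G => translate x φ := by
  have : Fact ((1 : ℝ≥0∞) ≠ ∞) := ⟨by simp⟩
  have h : Continuous fun x : G => DomMulAct.mk x⁻¹ :=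
    DomMulAct.continuous_mk.comp continuous_inv
  exact h.smul continuous_const

theorem norm_translate (x : G) (φ : L1 lam) : ‖translate x φ‖ = ‖φ‖ :=
  DomMulAct.norm_smul_Lp _ _

/-- The convolution product of `L¹(G)`, `φ * ψ = ∫ φ(x) (translate x ψ) dx`, that is,
`(φ * ψ)(y) = ∫ φ(x) ψ(x⁻¹ y) dx`. The integral is a Bochner integral in `L¹(G)`, which always
converges (`integrable_conv`). As an element of `C₀(G)*`, `φ * ψ` is
`f ↦ ∫ ∫ f(x y) φ(x) ψ(y) dy dx` (`integral_mul_conv`). -/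
def conv (φ ψ : L1 lam) : L1 lam := ∫ x, φ x • translate x ψ ∂lam

/-- The convolution `μ * φ ∈ L¹(G)` of a measure `μ ∈ M(G)` and a function `φ ∈ L¹(G)`,
`μ * φ = ∫ (translate x φ) dμ(x)`, that is, `(μ * φ)(y) = ∫ φ(x⁻¹ y) dμ(x)`. The integral against
the complex measure `μ` is a Bochner integral in `L¹(G)`, which always converges
(`integrable_measureConv`); the pairing `(lsmul ℝ ℂ).flip` is `(φ, z) ↦ z • φ`. As an element of
`C₀(G)*`, `μ * φ` is `f ↦ ∫ ∫ f(x y) φ(y) dy dμ(x)` (`integral_mul_measureConv`). -/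
def measureConv (μ : MeasureAlgebra G) (φ : L1 lam) : L1 lam :=
  μ.1.integral (fun x => translate x φ) (ContinuousLinearMap.lsmul ℝ ℂ).flip

theorem integrable_conv (φ ψ : L1 lam) : Integrable (fun x => φ x • translate x ψ) lam :=
  integrable_smul_continuous (L1.integrable_coeFn φ) (continuous_translate ψ)
    fun x => (norm_translate x ψ).le

theorem integrable_measureConv (μ : MeasureAlgebra G) (φ : L1 lam) :
    μ.1.Integrable (fun x => translate x φ) := by
  simpa using integrable_smul_continuous (𝕜 := ℝ) (integrable_const (1 : ℝ))
    (m := μ.1.variation) (continuous_translate φ) fun x => (norm_translate x φ).le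

theorem integrable_mul (f : C₀(G, ℂ)) (φ : L1 lam) : Integrable (fun y => f y * φ y) lam :=
  (L1.integrable_coeFn φ).bdd_mul f.continuous.measurable.aestronglyMeasurable
    (c := ‖f‖) (Filter.Eventually.of_forall fun y => f.toBCF.norm_coe_le_norm y)

/-- Integration against `f ∈ C₀(G)`, as a functional on `L¹(G)`. -/
def pairing (f : C₀(G, ℂ)) : L1 lam →L[ℂ] ℂ :=
  LinearMap.mkContinuous
    { toFun := fun ψ => ∫ y, f y * ψ y ∂lam
      map_add' := fun φ ψ => by
        rw [← integral_add (integrable_mul f φ) (integrable_mul f ψ)]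
        refine integral_congr_ae ?_
        filter_upwards [Lp.coeFn_add φ ψ] with y hy
        rw [hy, Pi.add_apply, mul_add]
      map_smul' := fun c φ => by
        rw [RingHom.id_apply, smul_eq_mul, ← integral_const_mul]
        refine integral_congr_ae ?_
        filter_upwards [Lp.coeFn_smul c φ] with y hy
        rw [hy, Pi.smul_apply, smul_eq_mul, mul_left_comm] } ‖f‖ fun φ => by
    rw [L1.norm_eq_integral_norm, ← integral_const_mul]
    refine norm_integral_le_of_norm_le ((L1.integrable_coeFn φ).norm.const_mul _)
      (Filter.Eventually.of_forall fun y => ?_)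
    rw [norm_mul]
    gcongr
    exact f.toBCF.norm_coe_le_norm y

theorem pairing_translate (f : C₀(G, ℂ)) (x : G) (φ : L1 lam) :
    pairing f (translate x φ) = ∫ y, f (x * y) * φ y ∂lam := by
  change ∫ y, f y * translate x φ y ∂lam = _
  rw [← integral_mul_left_eq_self (μ := lam) (fun y => f y * translate x φ y) x]
  refine integral_congr_ae ?_
  have h := (measurePreserving_mul_left lam x).quasiMeasurePreserving.ae (translate_ae x φ)
  filter_upwards [h] with y hy
  simp only [hy, inv_mul_cancel_left]

/-- `φ * ψ` is the convolution of the measures `φ dx` and `ψ dy`. -/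
theorem integral_mul_conv (φ ψ : L1 lam) (f : C₀(G, ℂ)) :
    ∫ z, f z * conv φ ψ z ∂lam = ∫ x, (∫ y, f (x * y) * ψ y ∂lam) * φ x ∂lam := by
  change pairing f (conv φ ψ) = _
  rw [conv, ← ContinuousLinearMap.integral_comp_comm _ (integrable_conv φ ψ)]
  simp only [map_smul, pairing_translate, smul_eq_mul, mul_comm (φ _)]

/-- `μ * φ` is the convolution of the measures `μ` and `φ dy`. -/
theorem integral_mul_measureConv (μ : MeasureAlgebra G) (φ : L1 lam) (f : C₀(G, ℂ)) :
    ∫ z, f z * measureConv μ φ z ∂lam =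
      μ.1.integral (fun x => ∫ y, f (x * y) * φ y ∂lam) (ContinuousLinearMap.mul ℝ ℂ) := by
  change (pairing f).restrictScalars ℝ (measureConv μ φ) = _
  rw [measureConv, VectorMeasure.continuousLinearMap_apply_integral (integrable_measureConv μ φ)]
  simp only [← pairing_translate]
  refine Eq.trans ?_ (VectorMeasure.integral_continuousLinearMap_comp
    (B := ContinuousLinearMap.mul ℝ ℂ) (C := (pairing f).restrictScalars ℝ)
    (f := fun x => translate x φ) (integrable_measureConv μ φ)).symm
  congr 1
  ext φ
  simp [mul_comm]

theorem add_conv (φ φ' ψ : L1 lam) : conv (φ + φ') ψ = conv φ ψ + conv φ' ψ := by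
  rw [conv, conv, conv, ← integral_add (integrable_conv _ _) (integrable_conv _ _)]
  refine integral_congr_ae ?_
  filter_upwards [Lp.coeFn_add φ φ'] with x hx
  rw [hx, Pi.add_apply, add_smul]

theorem smul_conv (c : ℂ) (φ ψ : L1 lam) : conv (c • φ) ψ = c • conv φ ψ := by
  rw [conv, conv, ← integral_smul]
  refine integral_congr_ae ?_
  filter_upwards [Lp.coeFn_smul c φ] with x hx
  rw [hx, Pi.smul_apply, smul_assoc]

/-- `T : L¹(G) → L¹(G)` is a Jordan left `α`-centralizer: it is additive and
`T (a²) = T a * α a`. -/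
structure IsJordanLeftCentralizer (α T : L1 lam → L1 lam) : Prop where
  map_add : ∀ a b, T (a + b) = T a + T b
  map_sq : ∀ a, T (conv a a) = conv (T a) (α a)

/-- `JL^c_α(L¹(G))`: the space of bounded linear operators on `L¹(G)` that are Jordan left
`α`-centralizers, with the operator norm. -/
def JL (α : L1 lam →L[ℂ] L1 lam) : Submodule ℂ (L1 lam →L[ℂ] L1 lam) where
  carrier := {T | IsJordanLeftCentralizer α T}
  zero_mem' := ⟨by simp, fun a => by simpa using (smul_conv 0 0 (α a)).symm⟩
  add_mem' := fun {S T} hS hT => ⟨map_add _, fun a => by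
    simp [hS.map_sq, hT.map_sq, add_conv]⟩
  smul_mem' := fun c T hT => ⟨map_add _, fun a => by simp [hT.map_sq, smul_conv]⟩

/-- The map `Λ_{μ,α} = λ_μ ∘ α`, `φ ↦ μ * α φ`. -/
def Lam (μ : MeasureAlgebra G) (α : L1 lam → L1 lam) (φ : L1 lam) : L1 lam :=
  measureConv μ (α φ)

end L1

end GroupAlgebra

end

noncomputable section

set_option linter.unusedSectionVars false

open Filter
open scoped Pointwise
open TopologicalSpace (OpenNhdsOf)

/-! Polarizing the Jordan identity gives `T (a*b + b*a) = T a * α b + T b * α a`. Take `a = e i`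
from a bounded two-sided approximate identity. The left side tends to `2 T b` by continuity. By
surjectivity `T b = α c` for some `c`, so `T b * α (e i) = α (c * e i)` tends to `T b`. Hence `T (e
i) * α b` tends to `T b` (`IsJordanLeftCentralizer.tendsto_conv`). Every approximant is
complex-linear in `b`, and so is `T`.

The densities `T (e i)` have mass at most `‖T‖`, so along an ultrafilter they converge vaguely to
some `μ` in `M(G)` (`exists_measureAlgebra_tendsto`). Pairing `T (e i) * g` with a test function `f`
integrates the compactly supported continuous function `x ↦ ∫ f (x y) g y dy` against `T (e i)`, and
the vague limit of this is the pairing of `f` with `μ * g`. Thus `T b = μ * α b` whenever `α b` is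
continuous with compact support. Such `b` are dense because `α` is open.

Conversely, convolution by `μ` commutes with right convolution, so `μ * α (·)` is a centralizer.
Convolution is a faithful action, which makes `μ` unique. The bounds `‖Γ μ‖ ≤ ‖α‖ ‖μ‖` and `‖μ‖ ≤ 4
‖T‖` give continuity in both directions. -/

namespace GroupAlgebra

/-! ### Complex multiples of finite positive measures. -/

section ScaledMeasure

variable {X : Type*} [MeasurableSpace X]

/-- The complex measure `c • m`, for a finite positive measure `m`. -/
def scaledMeasure (c : ℂ) (m : Measure X) [IsFiniteMeasure m] : ComplexMeasure X :=
  m.toSignedMeasure.mapRange (LinearMap.toSpanSingleton ℝ ℂ c).toAddMonoidHom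
    (by
      change Continuous fun r : ℝ => r • c
      fun_prop)

theorem scaledMeasure_apply (c : ℂ) (m : Measure X) [IsFiniteMeasure m] {s : Set X}
    (hs : MeasurableSet s) : scaledMeasure c m s = m.real s • c := by
  simp [scaledMeasure, Measure.toSignedMeasure_apply_measurable hs]

theorem variation_scaledMeasure_le (c : ℂ) (m : Measure X) [IsFiniteMeasure m] :
    (scaledMeasure c m).variation ≤ ‖c‖₊ • m := by
  refine VectorMeasure.variation_le_of_forall_enorm_le fun s hs => ?_
  rw [scaledMeasure_apply c m hs, enorm_smul, Measure.smul_apply, mul_comm,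
    Real.enorm_eq_ofReal measureReal_nonneg, ofReal_measureReal]
  rfl

theorem integral_scaledMeasure (c : ℂ) (m : Measure X) [IsFiniteMeasure m] {f : X → ℂ}
    (hf : Integrable f m) :
    (scaledMeasure c m).integral f (ContinuousLinearMap.mul ℝ ℂ) = (∫ x, f x ∂m) * c := by
  set T := (scaledMeasure c m).transpose (ContinuousLinearMap.mul ℝ ℂ) with hT
  have hTs : ∀ s, MeasurableSet s → ∀ z, T s z = z * (m.real s • c) := fun s hs z => by
    rw [← scaledMeasure_apply c m hs]
    exact MeasureTheory.cbmApplyMeasure_apply (scaledMeasure c m) (ContinuousLinearMap.mul ℝ ℂ) s z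
  have hdom : DominatedFinMeasAdditive m T ‖c‖ := by
    refine ⟨fun s t hs ht _ _ hd => MeasureTheory.cbmApplyMeasure_union
      (scaledMeasure c m) (ContinuousLinearMap.mul ℝ ℂ) hs ht hd,
      fun s hs _ => ContinuousLinearMap.opNorm_le_bound _ (by positivity) fun z => ?_⟩
    rw [hTs s hs, norm_mul, norm_smul, Real.norm_of_nonneg measureReal_nonneg]
    exact le_of_eq (by ring)
  -- The integral is built over the variation, which is dominated by `‖c‖ • m`, so for
  -- `m`-integrable `f` it may be computed over `m` instead.
  have h1 : (scaledMeasure c m).integral f (ContinuousLinearMap.mul ℝ ℂ) =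
      setToFun m T hdom f := by
    rw [VectorMeasure.integral_eq_setToFun]
    exact (setToFun_congr_measure_of_integrable ‖c‖₊ (by simp)
      (variation_scaledMeasure_le c m) _ _ _ hf).symm
  rw [h1]
  refine hf.induction (fun f => setToFun m T hdom f = (∫ x, f x ∂m) * c) ?_ ?_ ?_ ?_
  · intro z s hs hm
    rw [setToFun_indicator_const hdom hs hm.ne, hTs _ hs, integral_indicator_const _ hs]
    simp only [Complex.real_smul]
    ring
  · intro f g _ hf hg ihf ihg
    rw [setToFun_add hdom hf hg, ihf, ihg, integral_add' hf hg, add_mul]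
  · exact isClosed_eq (continuous_setToFun hdom) (continuous_integral.mul continuous_const)
  · intro f g hfg _ hf
    rw [← setToFun_congr_ae hdom hfg, hf, integral_congr_ae hfg]

end ScaledMeasure

/-! ### Regular complex measures as combinations of four positive ones. -/

section Regular

variable {X : Type*} [TopologicalSpace X] [T2Space X] [MeasurableSpace X] [BorelSpace X]

/-- The measure `c • m` in `M(X)`, for a finite positive regular measure `m`. -/
def ofMeasure (c : ℂ) (m : Measure X) [IsFiniteMeasure m] [m.Regular] : MeasureAlgebra X :=
  ⟨scaledMeasure c m, isFiniteMeasure_of_le _ (variation_scaledMeasure_le c m),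
    regular_of_le (variation_scaledMeasure_le c m)⟩

theorem norm_ofMeasure_le (c : ℂ) (m : Measure X) [IsFiniteMeasure m] [m.Regular] :
    ‖ofMeasure c m‖ ≤ ‖c‖ * m.real Set.univ := by
  have h := variation_scaledMeasure_le c m Set.univ
  have h2 := ENNReal.toReal_mono (measure_ne_top _ _) h
  rw [norm_def]
  refine h2.trans_eq ?_
  rw [Measure.smul_apply, ENNReal.smul_def, smul_eq_mul, ENNReal.toReal_mul]
  rfl

theorem variation_re_le (μ : ComplexMeasure X) :
    (ComplexMeasure.re μ).variation ≤ μ.variation :=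
  VectorMeasure.variation_le_of_forall_enorm_le fun s _ => by
    refine le_trans ?_ (VectorMeasure.enorm_measure_le_variation μ s)
    rw [ComplexMeasure.re_apply]
    exact enorm_le_iff_norm_le.2 (Complex.abs_re_le_norm _)

theorem variation_im_le (μ : ComplexMeasure X) :
    (ComplexMeasure.im μ).variation ≤ μ.variation :=
  VectorMeasure.variation_le_of_forall_enorm_le fun s _ => by
    refine le_trans ?_ (VectorMeasure.enorm_measure_le_variation μ s)
    rw [ComplexMeasure.im_apply]
    exact enorm_le_iff_norm_le.2 (Complex.abs_im_le_norm _)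

/-- The variation of `s` is the sum of its Jordan parts, so each part is dominated by the finite
regular measure `v`. -/
theorem regular_posPart {s : SignedMeasure X} {v : Measure X} [IsFiniteMeasure v] [v.Regular]
    (h : s.variation ≤ v) : s.toJordanDecomposition.posPart.Regular := by
  rw [← SignedMeasure.totalVariation_eq_variation] at h
  exact regular_of_le ((Measure.le_add_right le_rfl).trans h)

theorem regular_negPart {s : SignedMeasure X} {v : Measure X} [IsFiniteMeasure v] [v.Regular]
    (h : s.variation ≤ v) : s.toJordanDecomposition.negPart.Regular := by
  rw [← SignedMeasure.totalVariation_eq_variation] at h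
  exact regular_of_le ((Measure.le_add_left le_rfl).trans h)

/-- Reduces questions about complex measures to positive ones, where the Riesz theorem applies. -/
theorem eq_sum_scaledMeasure (μ : ComplexMeasure X) :
    μ = scaledMeasure 1 (ComplexMeasure.re μ).toJordanDecomposition.posPart +
      scaledMeasure (-1) (ComplexMeasure.re μ).toJordanDecomposition.negPart +
      (scaledMeasure Complex.I (ComplexMeasure.im μ).toJordanDecomposition.posPart +
      scaledMeasure (-Complex.I) (ComplexMeasure.im μ).toJordanDecomposition.negPart) := by
  ext s hs
  have h1 := SignedMeasure.apply_eq_posPart_real_sub_negPart_real (ComplexMeasure.re μ) hs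
  have h2 := SignedMeasure.apply_eq_posPart_real_sub_negPart_real (ComplexMeasure.im μ) hs
  rw [ComplexMeasure.re_apply] at h1
  rw [ComplexMeasure.im_apply] at h2
  simp only [_root_.add_apply, scaledMeasure_apply _ _ hs]
  refine Complex.ext ?_ ?_
  · refine h1.trans ?_
    simp [sub_eq_add_neg]
  · refine h2.trans ?_
    simp [sub_eq_add_neg]

theorem integrable_of_hasCompactSupport (μ : MeasureAlgebra X) {f : X → ℂ} (hf : Continuous f)
    (hs : HasCompactSupport f) : μ.1.Integrable f :=
  hf.integrable_of_hasCompactSupport hs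

theorem integral_add_measureAlgebra (μ ν : MeasureAlgebra X) {f : X → ℂ} (hf : Continuous f)
    (hs : HasCompactSupport f) :
    (μ + ν).1.integral f (ContinuousLinearMap.mul ℝ ℂ) =
      μ.1.integral f (ContinuousLinearMap.mul ℝ ℂ) +
        ν.1.integral f (ContinuousLinearMap.mul ℝ ℂ) :=
  VectorMeasure.integral_add_vectorMeasure (integrable_of_hasCompactSupport μ hf hs)
    (integrable_of_hasCompactSupport ν hf hs)

theorem integral_ofMeasure (c : ℂ) (m : Measure X) [IsFiniteMeasure m] [m.Regular] {f : X → ℂ}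
    (hf : Continuous f) (hs : HasCompactSupport f) :
    (ofMeasure c m).1.integral f (ContinuousLinearMap.mul ℝ ℂ) = (∫ x, f x ∂m) * c :=
  integral_scaledMeasure c m (hf.integrable_of_hasCompactSupport hs)

/-- A regular complex measure is determined by its integrals of compactly supported continuous
functions. -/
theorem eq_zero_of_forall_integral_eq_zero [LocallyCompactSpace X] (μ : MeasureAlgebra X)
    (h : ∀ f : X → ℂ, Continuous f → HasCompactSupport f →
      μ.1.integral f (ContinuousLinearMap.mul ℝ ℂ) = 0) : μ = 0 := by
  set J := (ComplexMeasure.re μ.1).toJordanDecomposition with hJ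
  set J' := (ComplexMeasure.im μ.1).toJordanDecomposition with hJ'
  have hp : J.posPart.Regular := regular_posPart (variation_re_le μ.1)
  have hq : J.negPart.Regular := regular_negPart (variation_re_le μ.1)
  have hr : J'.posPart.Regular := regular_posPart (variation_im_le μ.1)
  have ht : J'.negPart.Regular := regular_negPart (variation_im_le μ.1)
  have hμ : μ = ofMeasure 1 J.posPart + ofMeasure (-1) J.negPart +
      (ofMeasure Complex.I J'.posPart + ofMeasure (-Complex.I) J'.negPart) :=
    Subtype.ext (eq_sum_scaledMeasure μ.1)
  -- On real test functions, the real and imaginary parts of the hypothesis decouple the two Jordan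
  -- decompositions. Riesz uniqueness then identifies the positive and negative parts, and
  -- everything cancels.
  have key : ∀ f : CompactlySupportedContinuousMap X ℝ,
      ∫ x, f x ∂J.posPart = ∫ x, f x ∂J.negPart ∧
        ∫ x, f x ∂J'.posPart = ∫ x, f x ∂J'.negPart := by
    intro f
    have hf : Continuous fun x => (f x : ℂ) := Complex.continuous_ofReal.comp f.continuous
    have hs : HasCompactSupport fun x => (f x : ℂ) :=
      f.hasCompactSupport.comp_left Complex.ofReal_zero
    have e := h _ hf hs
    rw [hμ] at e
    simp only [integral_add_measureAlgebra _ _ hf hs, integral_ofMeasure _ _ hf hs] at e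
    simp only [integral_complex_ofReal] at e
    have e1 := congrArg Complex.re e
    have e2 := congrArg Complex.im e
    simp at e1 e2
    exact ⟨by linarith, by linarith⟩
  have h1 : J.posPart = J.negPart :=
    Measure.ext_of_integral_eq_on_compactlySupported fun f => (key f).1
  have h2 : J'.posPart = J'.negPart :=
    Measure.ext_of_integral_eq_on_compactlySupported fun f => (key f).2
  refine Subtype.ext ?_
  rw [eq_sum_scaledMeasure μ.1]
  ext s hs
  simp only [_root_.add_apply, scaledMeasure_apply _ _ hs, ← hJ, ← hJ', h1, h2]
  simp

end Regular

/-! ### Vague limits of bounded families of densities. -/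

section Limits

variable {X : Type*} [TopologicalSpace X] [T2Space X] [LocallyCompactSpace X] [MeasurableSpace X]
  [BorelSpace X] {m₀ : Measure X} {ι : Type*}

theorem integrable_compactlySupported_mul {𝕜 : Type*} [RCLike 𝕜] {F p : X → 𝕜} (hF : Continuous F)
    (hs : HasCompactSupport F) (hp : Integrable p m₀) : Integrable (fun x => F x * p x) m₀ := by
  obtain ⟨M, hM⟩ := hs.exists_bound_of_continuous hF
  exact hp.bdd_mul hF.measurable.aestronglyMeasurable (c := M) (Eventually.of_forall hM)

/-- Along an ultrafilter, nonnegative densities of bounded mass converge vaguely to a finite regular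
measure. -/
theorem exists_tendsto_integral_mul (U : Ultrafilter ι) {p : ι → X → ℝ} {C : ℝ} (hC : 0 ≤ C)
    (hp0 : ∀ i x, 0 ≤ p i x) (hpi : ∀ i, Integrable (p i) m₀) (hpC : ∀ i, ∫ x, p i x ∂m₀ ≤ C) :
    ∃ (m : Measure X) (_ : IsFiniteMeasure m) (_ : m.Regular), m.real Set.univ ≤ C ∧
      ∀ F : X → ℝ, Continuous F → HasCompactSupport F →
        Tendsto (fun i => ∫ x, F x * p i x ∂m₀) U (𝓝 (∫ x, F x ∂m)) := by
  have bound : ∀ (F : X → ℝ) (M : ℝ), 0 ≤ M → (∀ x, ‖F x‖ ≤ M) → ∀ i,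
      ‖∫ x, F x * p i x ∂m₀‖ ≤ M * C := by
    intro F M hM0 hM i
    refine (norm_integral_le_of_norm_le ((hpi i).const_mul M)
      (Eventually.of_forall fun x => ?_)).trans ?_
    · rw [norm_mul, Real.norm_of_nonneg (hp0 i x)]
      exact mul_le_mul_of_nonneg_right (hM x) (hp0 i x)
    · rw [integral_const_mul]
      exact mul_le_mul_of_nonneg_left (hpC i) hM0
  have lim : ∀ F : CompactlySupportedContinuousMap X ℝ,
      ∃ z : ℝ, Tendsto (fun i => ∫ x, F x * p i x ∂m₀) U (𝓝 z) := by
    intro F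
    obtain ⟨M, hM⟩ := F.hasCompactSupport.exists_bound_of_continuous F.continuous
    -- The values stay in a compact ball, where every ultrafilter converges. The absolute value
    -- covers an empty `X`, for which `M` may be negative.
    obtain ⟨z, -, hz⟩ := (isCompact_closedBall (0 : ℝ) (|M| * C)).ultrafilter_le_nhds
      (U.map fun i => ∫ x, F x * p i x ∂m₀) (by
        rw [le_principal_iff, Ultrafilter.mem_coe, Ultrafilter.mem_map]
        exact Filter.univ_mem' fun i => by
          simpa using bound F |M| (abs_nonneg M) (fun x => (hM x).trans (le_abs_self M)) i)
    exact ⟨z, hz⟩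
  choose L hL using lim
  have hint : ∀ (F : CompactlySupportedContinuousMap X ℝ) i,
      Integrable (fun x => F x * p i x) m₀ := fun F i =>
    integrable_compactlySupported_mul F.continuous F.hasCompactSupport (hpi i)
  -- Linearity and positivity survive the limit, so the Riesz–Markov theorem represents it by a
  -- regular measure.
  let Λ : CompactlySupportedContinuousMap X ℝ →ₚ[ℝ] ℝ := PositiveLinearMap.mk₀
    { toFun := L
      map_add' := fun F F' => by
        refine tendsto_nhds_unique (hL (F + F')) (((hL F).add (hL F')).congr fun i => ?_)
        rw [← integral_add (hint F i) (hint F' i)]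
        simp only [CompactlySupportedContinuousMap.coe_add, Pi.add_apply, add_mul]
      map_smul' := fun c F => by
        refine tendsto_nhds_unique (hL (c • F)) (((hL F).const_mul c).congr fun i => ?_)
        rw [← integral_const_mul]
        simp only [CompactlySupportedContinuousMap.coe_smul, Pi.smul_apply, smul_eq_mul,
          mul_assoc] }
    fun F hF => ge_of_tendsto' (hL F) fun i =>
      integral_nonneg fun x => mul_nonneg (hF x) (hp0 i x)
  have hreg : (RealRMK.rieszMeasure Λ).Regular := inferInstance
  -- By inner regularity it suffices to bound compact sets `K`; a Urysohn function equal to 1 on `K`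
  -- and at most 1 everywhere has `Λ`-value at most `C`.
  have huniv : RealRMK.rieszMeasure Λ Set.univ ≤ ENNReal.ofReal C := by
    rw [isOpen_univ.measure_eq_iSup_isCompact]
    refine iSup₂_le fun K _ => iSup_le fun hK => ?_
    obtain ⟨f, hf1, -, hfs, hf⟩ := exists_continuous_one_zero_of_isCompact hK isClosed_empty
      (Set.disjoint_empty K)
    let F : CompactlySupportedContinuousMap X ℝ := ⟨f, hfs⟩
    refine (RealRMK.rieszMeasure_le_of_eq_one Λ (f := F) (fun x => (hf x).1) hK
      fun x hx => hf1 hx).trans (ENNReal.ofReal_le_ofReal ?_)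
    refine le_of_tendsto' (hL F) fun i => (le_abs_self _).trans ?_
    have := bound f 1 zero_le_one (fun x => by
      rw [Real.norm_of_nonneg (hf x).1]
      exact (hf x).2) i
    rwa [one_mul] at this
  have hfin : IsFiniteMeasure (RealRMK.rieszMeasure Λ) :=
    ⟨huniv.trans_lt ENNReal.ofReal_lt_top⟩
  refine ⟨RealRMK.rieszMeasure Λ, hfin, hreg, ENNReal.toReal_le_of_le_ofReal hC huniv,
    fun F hF hs => ?_⟩
  have e := RealRMK.integral_rieszMeasure Λ ⟨⟨F, hF⟩, hs⟩
  have h := hL ⟨⟨F, hF⟩, hs⟩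
  change ∫ x, F x ∂_ = L ⟨⟨F, hF⟩, hs⟩ at e
  rwa [← e] at h

theorem tendsto_integral_mul_ofReal {l : Filter ι} {p : ι → X → ℝ}
    (hpi : ∀ i, Integrable (p i) m₀) {m : Measure X} [IsFiniteMeasure m]
    (h : ∀ F : X → ℝ, Continuous F → HasCompactSupport F →
      Tendsto (fun i => ∫ x, F x * p i x ∂m₀) l (𝓝 (∫ x, F x ∂m)))
    {F : X → ℂ} (hF : Continuous F) (hs : HasCompactSupport F) :
    Tendsto (fun i => ∫ x, F x * (p i x : ℂ) ∂m₀) l (𝓝 (∫ x, F x ∂m)) := by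
  have hi : ∀ i, Integrable (fun x => F x * (p i x : ℂ)) m₀ := fun i =>
    integrable_compactlySupported_mul hF hs (hpi i).ofReal
  have hFm : Integrable F m := hF.integrable_of_hasCompactSupport hs
  have split : ∀ (n : Measure X) {f : X → ℂ}, Integrable f n →
      ∫ x, f x ∂n = ((∫ x, (f x).re ∂n : ℝ) : ℂ) + ((∫ x, (f x).im ∂n : ℝ) : ℂ) * Complex.I :=
    fun n f hf => (integral_re_add_im hf).symm
  rw [split m hFm]
  simp only [split m₀ (hi _), Complex.re_mul_ofReal, Complex.im_mul_ofReal]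
  have hre := h (fun x => (F x).re) (Complex.continuous_re.comp hF)
    (hs.comp_left (g := Complex.re) Complex.zero_re)
  have him := h (fun x => (F x).im) (Complex.continuous_im.comp hF)
    (hs.comp_left (g := Complex.im) Complex.zero_im)
  exact ((Complex.continuous_ofReal.tendsto _).comp hre).add
    (((Complex.continuous_ofReal.tendsto _).comp him).mul_const _)

/-- Along an ultrafilter, complex densities of bounded mass converge vaguely to a regular complex
measure. -/
theorem exists_measureAlgebra_tendsto (U : Ultrafilter ι) {h : ι → X → ℂ} {C : ℝ} (hC : 0 ≤ C)
    (hi : ∀ i, Integrable (h i) m₀) (hhC : ∀ i, ∫ x, ‖h i x‖ ∂m₀ ≤ C) :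
    ∃ μ : MeasureAlgebra X, ‖μ‖ ≤ 4 * C ∧ ∀ F : X → ℂ, Continuous F → HasCompactSupport F →
      Tendsto (fun i => ∫ x, F x * h i x ∂m₀) U
        (𝓝 (μ.1.integral F (ContinuousLinearMap.mul ℝ ℂ))) := by
  -- Used for the positive parts of `re`, `-re`, `im` and `-im`. Each limit has mass at most `C`,
  -- whence the factor 4.
  have part : ∀ T : ℂ →L[ℝ] ℝ, (∀ z, ‖T z‖ ≤ ‖z‖) →
      ∃ (m : Measure X) (_ : IsFiniteMeasure m) (_ : m.Regular), m.real Set.univ ≤ C ∧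
        ∀ F : X → ℂ, Continuous F → HasCompactSupport F →
          Tendsto (fun i => ∫ x, F x * ((max (T (h i x)) 0 : ℝ) : ℂ) ∂m₀) U
            (𝓝 (∫ x, F x ∂m)) := by
    intro T hT
    have hpi : ∀ i, Integrable (fun x => max (T (h i x)) 0) m₀ := fun i =>
      (T.integrable_comp (hi i)).pos_part
    obtain ⟨m, hfin, hreg, hm, hlim⟩ := exists_tendsto_integral_mul (m₀ := m₀) U
      (p := fun i x => max (T (h i x)) 0) hC (fun i x => le_max_right _ _) hpi
      fun i => (integral_mono (hpi i) (hi i).norm fun x => max_le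
        ((le_abs_self _).trans (hT _)) (norm_nonneg _)).trans (hhC i)
    exact ⟨m, hfin, hreg, hm, fun F hF hs => tendsto_integral_mul_ofReal hpi hlim hF hs⟩
  obtain ⟨m₁, _, _, hm₁, h₁⟩ := part Complex.reCLM Complex.abs_re_le_norm
  obtain ⟨m₂, _, _, hm₂, h₂⟩ := part (-Complex.reCLM) fun z => by
    simpa using Complex.abs_re_le_norm z
  obtain ⟨m₃, _, _, hm₃, h₃⟩ := part Complex.imCLM Complex.abs_im_le_norm
  obtain ⟨m₄, _, _, hm₄, h₄⟩ := part (-Complex.imCLM) fun z => by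
    simpa using Complex.abs_im_le_norm z
  refine ⟨ofMeasure 1 m₁ + ofMeasure (-1) m₂ +
    (ofMeasure Complex.I m₃ + ofMeasure (-Complex.I) m₄), ?_, fun F hF hs => ?_⟩
  · have n₁ := norm_ofMeasure_le 1 m₁
    have n₂ := norm_ofMeasure_le (-1) m₂
    have n₃ := norm_ofMeasure_le Complex.I m₃
    have n₄ := norm_ofMeasure_le (-Complex.I) m₄
    simp only [norm_neg, norm_one, Complex.norm_I, one_mul] at n₁ n₂ n₃ n₄
    refine (norm_add_le _ _).trans ((add_le_add (norm_add_le _ _) (norm_add_le _ _)).trans ?_)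
    linarith
  · simp only [integral_add_measureAlgebra _ _ hF hs, integral_ofMeasure _ _ hF hs]
    refine (((h₁ F hF hs).mul_const 1).add ((h₂ F hF hs).mul_const (-1)) |>.add
      (((h₃ F hF hs).mul_const Complex.I).add ((h₄ F hF hs).mul_const (-Complex.I)))).congr
      fun i => ?_
    have hint : ∀ T : ℂ →L[ℝ] ℝ,
        Integrable (fun x => F x * ((max (T (h i x)) 0 : ℝ) : ℂ)) m₀ := fun T =>
      integrable_compactlySupported_mul hF hs (T.integrable_comp (hi i)).pos_part.ofReal
    have hadd : ∀ (T T' : ℂ →L[ℝ] ℝ) (c c' : ℂ),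
        Integrable (fun x => F x * ((max (T (h i x)) 0 : ℝ) : ℂ) * c +
          F x * ((max (T' (h i x)) 0 : ℝ) : ℂ) * c') m₀ := fun T T' c c' =>
      ((hint T).mul_const c).add ((hint T').mul_const c')
    rw [← integral_mul_const, ← integral_mul_const, ← integral_mul_const, ← integral_mul_const,
      ← integral_add ((hint _).mul_const _) ((hint _).mul_const _),
      ← integral_add ((hint _).mul_const _) ((hint _).mul_const _),
      ← integral_add (hadd _ _ _ _) (hadd _ _ _ _)]
    refine integral_congr_ae (Eventually.of_forall fun x => ?_)
    have hmax : ∀ r : ℝ, max r 0 - max (-r) 0 = r := fun r => by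
      rcases le_total r 0 with hr | hr
      · rw [max_eq_right hr, max_eq_left (neg_nonneg.2 hr)]; ring
      · rw [max_eq_left hr, max_eq_right (neg_nonpos.2 hr)]; ring
    have e1 := congrArg (fun r : ℝ => (r : ℂ)) (hmax (h i x).re)
    have e2 := congrArg (fun r : ℝ => (r : ℂ)) (hmax (h i x).im)
    simp only [Complex.ofReal_sub] at e1 e2
    have e3 := Complex.re_add_im (h i x)
    rw [← e1, ← e2] at e3
    dsimp only
    conv_rhs => rw [← e3]
    simp only [_root_.neg_apply, Complex.reCLM_apply, Complex.imCLM_apply]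
    ring

end Limits

/-! ### Bilinearity, norm bounds and associativity of convolution. -/

section Convolution

variable {G : Type*} [Group G] [TopologicalSpace G] [IsTopologicalGroup G] [LocallyCompactSpace G]
  [T2Space G] [MeasurableSpace G] [BorelSpace G]
  {lam : Measure G} [lam.IsHaarMeasure] [lam.Regular]

/-- Left translation on `L¹(G)` as a linear isometry. -/
def translateLI (x : G) : L1 lam →ₗᵢ[ℂ] L1 lam where
  toFun := translate x
  map_add' φ ψ := by simp [translate]
  map_smul' c φ := by
    simp only [translate, RingHom.id_apply]
    exact smul_comm _ _ _
  norm_map' := norm_translate x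

theorem translateLI_apply (x : G) (φ : L1 lam) : translateLI x φ = translate x φ := rfl

theorem translate_add (x : G) (φ ψ : L1 lam) :
    translate x (φ + ψ) = translate x φ + translate x ψ := (translateLI x).map_add φ ψ

theorem translate_smul (x : G) (c : ℂ) (φ : L1 lam) :
    translate x (c • φ) = c • translate x φ := (translateLI x).map_smul c φ

theorem translate_translate (x y : G) (φ : L1 lam) :
    translate x (translate y φ) = translate (x * y) φ := by
  simp only [translate, mul_inv_rev, DomMulAct.mk_mul, mul_smul]

theorem conv_add (φ ψ ψ' : L1 lam) : conv φ (ψ + ψ') = conv φ ψ + conv φ ψ' := by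
  simp only [conv, translate_add, smul_add]
  exact integral_add (integrable_conv _ _) (integrable_conv _ _)

theorem conv_smul (c : ℂ) (φ ψ : L1 lam) : conv φ (c • ψ) = c • conv φ ψ := by
  simp only [conv, translate_smul, smul_comm _ c]
  exact integral_smul _ _

theorem norm_conv_le (φ ψ : L1 lam) : ‖conv φ ψ‖ ≤ ‖φ‖ * ‖ψ‖ := by
  rw [L1.norm_eq_integral_norm φ, ← integral_mul_const]
  refine norm_integral_le_of_norm_le ((L1.integrable_coeFn φ).norm.mul_const _)
    (Eventually.of_forall fun x => ?_)
  rw [norm_smul, norm_translate]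

/-- Convolution on `L¹(G)` as a continuous bilinear map. -/
def convCLM : L1 lam →L[ℂ] L1 lam →L[ℂ] L1 lam :=
  LinearMap.mkContinuous₂ (LinearMap.mk₂ ℂ conv add_conv smul_conv conv_add conv_smul) 1
    fun φ ψ => by simpa using norm_conv_le φ ψ

theorem convCLM_apply (φ ψ : L1 lam) : convCLM φ ψ = conv φ ψ := rfl

theorem sub_conv (φ φ' ψ : L1 lam) : conv (φ - φ') ψ = conv φ ψ - conv φ' ψ :=
  convCLM.map_sub₂ φ φ' ψ

/-- Left invariance of Haar measure: substitute `x * y` for the integration variable. -/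
theorem translate_conv (x : G) (φ ψ : L1 lam) :
    conv (translate x φ) ψ = translate x (conv φ ψ) := by
  have h : translate x (conv φ ψ) = ∫ z, φ z • translate (x * z) ψ ∂lam := by
    change (translateLI x).toContinuousLinearMap (conv φ ψ) = _
    rw [conv, ← ContinuousLinearMap.integral_comp_comm _ (integrable_conv φ ψ)]
    refine integral_congr_ae (Eventually.of_forall fun z => ?_)
    change translateLI x (φ z • translate z ψ) = _
    rw [map_smul, translateLI_apply, translate_translate]
  rw [h, conv, ← integral_mul_left_eq_self (μ := lam) _ x]
  refine integral_congr_ae ?_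
  have h := (measurePreserving_mul_left lam x).quasiMeasurePreserving.ae (translate_ae x φ)
  filter_upwards [h] with y hy
  rw [hy, inv_mul_cancel_left]

theorem norm_lsmul_flip_le : ‖(ContinuousLinearMap.lsmul ℝ ℂ (E := L1 lam)).flip‖ ≤ 1 := by
  refine ContinuousLinearMap.opNorm_le_bound₂ _ zero_le_one fun φ z => ?_
  simp [norm_smul, mul_comm]

theorem norm_measureConv_le (μ : MeasureAlgebra G) (φ : L1 lam) :
    ‖measureConv μ φ‖ ≤ ‖μ‖ * ‖φ‖ := by
  have h := VectorMeasure.norm_integral_le_of_norm_le_const (μ := μ.1)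
    (B := (ContinuousLinearMap.lsmul ℝ ℂ (E := L1 lam)).flip) (f := fun x => translate x φ)
    (C := ‖φ‖) (Eventually.of_forall fun x => (norm_translate x φ).le)
  refine h.trans ?_
  rw [← norm_def, mul_comm ‖μ‖]
  gcongr
  exact mul_le_of_le_one_right (norm_nonneg _) norm_lsmul_flip_le

theorem measureConv_add (μ : MeasureAlgebra G) (φ ψ : L1 lam) :
    measureConv μ (φ + ψ) = measureConv μ φ + measureConv μ ψ := by
  simp only [measureConv, translate_add]
  exact VectorMeasure.integral_fun_add (integrable_measureConv μ φ) (integrable_measureConv μ ψ)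

theorem add_measureConv (μ ν : MeasureAlgebra G) (φ : L1 lam) :
    measureConv (μ + ν) φ = measureConv μ φ + measureConv ν φ :=
  VectorMeasure.integral_add_vectorMeasure (integrable_measureConv μ φ)
    (integrable_measureConv ν φ)

/-- A complex-linear operator on `L¹(G)` passes through the convolution integral. -/
theorem map_measureConv (μ : MeasureAlgebra G) (φ : L1 lam) (S : L1 lam →L[ℂ] L1 lam) :
    S (measureConv μ φ) =
      μ.1.integral (fun x => S (translate x φ)) (ContinuousLinearMap.lsmul ℝ ℂ).flip := by
  change S.restrictScalars ℝ (measureConv μ φ) = _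
  rw [measureConv, VectorMeasure.continuousLinearMap_apply_integral (integrable_measureConv μ φ)]
  refine Eq.trans ?_ (VectorMeasure.integral_continuousLinearMap_comp
    (B := (ContinuousLinearMap.lsmul ℝ ℂ).flip) (C := S.restrictScalars ℝ)
    (f := fun x => translate x φ) (integrable_measureConv μ φ)).symm
  congr 1
  ext φ
  simp

theorem measureConv_smul (μ : MeasureAlgebra G) (c : ℂ) (φ : L1 lam) :
    measureConv μ (c • φ) = c • measureConv μ φ := by
  -- The pairing is only real-bilinear, so the complex scalar is extracted as the operator `c • id`.
  have h := map_measureConv μ φ (c • ContinuousLinearMap.id ℂ (L1 lam))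
  rw [measureConv]
  simpa [translate_smul] using h.symm

/-- Convolution by a measure, as an operator on `L¹(G)`. -/
def measureConvCLM (μ : MeasureAlgebra G) : L1 lam →L[ℂ] L1 lam :=
  LinearMap.mkContinuous
    { toFun := measureConv μ
      map_add' := measureConv_add μ
      map_smul' := measureConv_smul μ } ‖μ‖ (norm_measureConv_le μ)

theorem measureConvCLM_apply (μ : MeasureAlgebra G) (φ : L1 lam) :
    measureConvCLM μ φ = measureConv μ φ := rfl

/-- Right convolution by `ψ` is bounded and commutes with left translations, so it passes through
the integral defining `measureConv`. This is what makes `μ * α (·)` a centralizer. -/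
theorem measureConv_conv (μ : MeasureAlgebra G) (φ ψ : L1 lam) :
    measureConv μ (conv φ ψ) = conv (measureConv μ φ) ψ := by
  have h := map_measureConv μ φ (convCLM.flip ψ)
  simp only [ContinuousLinearMap.flip_apply, convCLM_apply, translate_conv] at h
  exact h.symm

end Convolution

/-! ### Density of compactly supported functions, and approximate identities. -/

section ApproximateIdentity

variable {G : Type*} [Group G] [TopologicalSpace G] [IsTopologicalGroup G] [LocallyCompactSpace G]
  [T2Space G] [MeasurableSpace G] [BorelSpace G]
  {lam : Measure G} [lam.IsHaarMeasure] [lam.Regular]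

/-- A compactly supported continuous function as an element of `C₀(G)`. -/
def ccZeroAtInfty (f : G → ℂ) (hf : Continuous f) (hs : HasCompactSupport f) : C₀(G, ℂ) :=
  ⟨⟨f, hf⟩, hs.is_zero_at_infty⟩

variable (lam) in
/-- A compactly supported continuous function as an element of `L¹(G)`. -/
def ccL1 (f : G → ℂ) (hf : Continuous f) (hs : HasCompactSupport f) : L1 lam :=
  (hf.integrable_of_hasCompactSupport hs).toL1 f

theorem ccL1_ae (f : G → ℂ) (hf : Continuous f) (hs : HasCompactSupport f) :
    ccL1 lam f hf hs =ᵐ[lam] f := Integrable.coeFn_toL1 _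

theorem norm_sub_eq_integral (φ ψ : L1 lam) : ‖φ - ψ‖ = ∫ x, ‖φ x - ψ x‖ ∂lam := by
  rw [L1.norm_eq_integral_norm]
  refine integral_congr_ae ?_
  filter_upwards [Lp.coeFn_sub φ ψ] with x hx
  rw [hx, Pi.sub_apply]

/-- In a locally compact Hausdorff space, integrable functions are approximated in mean by
compactly supported continuous functions. -/
theorem exists_hasCompactSupport_eLpNorm_one_sub_le {X : Type*} [TopologicalSpace X] [T2Space X]
    [LocallyCompactSpace X] [MeasurableSpace X] [BorelSpace X] {m : Measure X} [m.Regular]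
    {φ : X → ℂ} (hφ : MemLp φ 1 m) {ε : ℝ≥0∞} (hε : ε ≠ 0) :
    ∃ f : X → ℂ, eLpNorm (φ - f) 1 m ≤ ε ∧ Continuous f ∧ HasCompactSupport f := by
  refine hφ.induction_dense ENNReal.one_ne_top (fun f => Continuous f ∧ HasCompactSupport f)
    ?_ ?_ ?_ hε
  rotate_left
  · rintro f g ⟨hf, hfs⟩ ⟨hg, hgs⟩
    exact ⟨hf.add hg, hfs.add hgs⟩
  · rintro f ⟨hf, hfs⟩
    exact (hf.integrable_of_hasCompactSupport hfs).aestronglyMeasurable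
  intro c s hs hsm ε hε
  obtain ⟨η, hη0, hη⟩ := exists_eLpNorm_indicator_le (μ := m) ENNReal.one_ne_top c hε
  have hη2 : (η : ℝ≥0∞) / 2 ≠ 0 := (ENNReal.half_pos (ENNReal.coe_ne_zero.2 hη0.ne')).ne'
  obtain ⟨K, hKs, hK, hKc, hKη⟩ := hs.exists_isCompact_isClosed_sdiff_lt hsm.ne hη2
  obtain ⟨V, hKV, hV, -, hVη⟩ := hKc.measurableSet.exists_isOpen_sdiff_lt
    (hK.measure_ne_top (μ := m)) hη2
  obtain ⟨f, hf1, hf0, hfs, hf⟩ := exists_continuous_one_zero_of_isCompact hK hV.isClosed_compl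
    (Set.disjoint_compl_right_iff_subset.2 hKV)
  -- The error is at most `‖c‖` and vanishes off `(V \ K) ∪ (s \ K)`, a set of measure at most `η`.
  refine ⟨fun x => (f x : ℂ) * c, (eLpNorm_mono fun x => ?_).trans
    (hη ((V \ K) ∪ (s \ K)) ?_), by fun_prop, ?_⟩
  · by_cases hxK : x ∈ K
    · simp [hf1 hxK, hKs hxK]
    · by_cases hxs : x ∈ s
      · have h1 : ‖((f x : ℝ) : ℂ) - 1‖ ≤ 1 := by
          rw [← Complex.ofReal_one, ← Complex.ofReal_sub, Complex.norm_real, Real.norm_eq_abs,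
            abs_le]
          constructor <;> linarith [(hf x).1, (hf x).2]
        simp only [Pi.sub_apply, Set.indicator, hxs, hxK, Set.mem_union, Set.mem_sdiff,
          not_false_eq_true, and_true, or_true, if_true]
        calc ‖(f x : ℂ) * c - c‖ = ‖(f x : ℂ) - 1‖ * ‖c‖ := by rw [← norm_mul, sub_mul, one_mul]
          _ ≤ ‖c‖ := mul_le_of_le_one_left (norm_nonneg _) h1
      · by_cases hxV : x ∈ V
        · simp only [Pi.sub_apply, Set.indicator, hxs, hxK, hxV, Set.mem_union, Set.mem_sdiff,
            not_false_eq_true, and_true, true_or, if_true, if_false, sub_zero, norm_mul,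
            Complex.norm_real, Real.norm_eq_abs, abs_of_nonneg (hf x).1]
          exact mul_le_of_le_one_left (norm_nonneg _) (hf x).2
        · have h0 : f x = 0 := hf0 hxV
          simp [hxs, hxV, h0]
  · exact (measure_union_le _ _).trans
      ((add_le_add hVη.le hKη.le).trans (ENNReal.add_halves _).le)
  · exact (hfs.comp_left (g := fun r : ℝ => (r : ℂ)) Complex.ofReal_zero).mul_right

theorem exists_norm_sub_ccL1_le (φ : L1 lam) {ε : ℝ} (hε : 0 < ε) :
    ∃ (f : G → ℂ) (hf : Continuous f) (hs : HasCompactSupport f), ‖φ - ccL1 lam f hf hs‖ ≤ ε := by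
  obtain ⟨f, h, hf, hs⟩ := exists_hasCompactSupport_eLpNorm_one_sub_le (Lp.memLp φ)
    (ENNReal.ofReal_pos.2 hε).ne'
  refine ⟨f, hf, hs, ?_⟩
  rw [Lp.norm_def]
  refine ENNReal.toReal_le_of_le_ofReal hε.le ((eLpNorm_congr_ae ?_).trans_le h)
  filter_upwards [Lp.coeFn_sub φ (ccL1 lam f hf hs), ccL1_ae (lam := lam) f hf hs] with x hx hx'
  rw [hx, Pi.sub_apply, hx', Pi.sub_apply]

theorem dense_ccL1 : Dense {φ : L1 lam | ∃ f hf hs, φ = ccL1 lam f hf hs} := by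
  refine Metric.dense_iff.2 fun φ r hr => ?_
  obtain ⟨f, hf, hs, h⟩ := exists_norm_sub_ccL1_le φ (half_pos hr)
  refine ⟨ccL1 lam f hf hs, ?_, f, hf, hs, rfl⟩
  rw [Metric.mem_ball, dist_comm, dist_eq_norm]
  linarith

/-- Compactly supported continuous functions separate the points of `L¹(G)`. -/
theorem eq_zero_of_forall_integral_mul_eq_zero (φ : L1 lam)
    (h : ∀ f : G → ℂ, Continuous f → HasCompactSupport f → ∫ x, f x * φ x ∂lam = 0) :
    φ = 0 := by
  rw [← norm_le_zero_iff]
  refine le_of_forall_pos_le_add fun ε hε => ?_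
  obtain ⟨u, hu, hs, hφu⟩ := exists_norm_sub_ccL1_le φ (ε := ε / 3) (by positivity)
  have hui : Integrable u lam := hu.integrable_of_hasCompactSupport hs
  set M := lam.real (tsupport u)
  have hM0 : 0 ≤ M := measureReal_nonneg
  set δ := ε / 3 / (M + 1) with hδdef
  have hδ : 0 < δ := by positivity
  -- A continuous substitute for the phase `conj u / |u|`: adding `δ` avoids division by zero and
  -- keeps `‖f‖ ≤ 1`. Since `f` annihilates `φ`, the integral of `f * u` is at most `‖u - φ‖`.
  set f : G → ℂ := fun x => (starRingEnd ℂ) (u x) / ((‖u x‖ + δ : ℝ) : ℂ) with hfdef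
  have hden : ∀ x, 0 < ‖u x‖ + δ := fun x => by positivity
  have hf : Continuous f := by
    refine (Complex.continuous_conj.comp hu).div
      (Complex.continuous_ofReal.comp (hu.norm.add continuous_const)) fun x => ?_
    exact_mod_cast (hden x).ne'
  have hfs : HasCompactSupport f := by
    refine hs.mono fun x hx => ?_
    contrapose! hx
    simp [hfdef, Function.notMem_support.1 hx]
  have hf1 : ∀ x, ‖f x‖ ≤ 1 := fun x => by
    simp only [hfdef, norm_div, RCLike.norm_conj, Complex.norm_real, Real.norm_eq_abs,
      abs_of_pos (hden x)]
    rw [div_le_one (hden x)]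
    linarith
  have hfu : ∀ x, f x * u x = ((‖u x‖ ^ 2 / (‖u x‖ + δ) : ℝ) : ℂ) := fun x => by
    simp only [hfdef]
    rw [div_mul_eq_mul_div, mul_comm, Complex.mul_conj, Complex.normSq_eq_norm_sq]
    push_cast
    rfl
  have hint : Integrable (fun x => f x * u x) lam :=
    (hf.mul hu).integrable_of_hasCompactSupport hs.mul_left
  have hintr : Integrable (fun x => ‖u x‖ ^ 2 / (‖u x‖ + δ)) lam := by
    refine hint.re.congr (Eventually.of_forall fun x => ?_)
    change (f x * u x).re = _
    rw [hfu, Complex.ofReal_re]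
  have h1 : ∫ x, ‖u x‖ ^ 2 / (‖u x‖ + δ) ∂lam ≤ ε / 3 := by
    have h2 : ∫ x, f x * u x ∂lam = ∫ x, f x * (u x - φ x) ∂lam := by
      simp only [mul_sub]
      have hi : Integrable (fun x => f x * φ x) lam := integrable_mul (ccZeroAtInfty f hf hfs) φ
      rw [integral_sub hint hi, h f hf hfs, sub_zero]
    have h3 : ‖∫ x, f x * u x ∂lam‖ ≤ ε / 3 := by
      rw [h2]
      refine (norm_integral_le_of_norm_le ((L1.integrable_coeFn φ).sub hui).norm
        (Eventually.of_forall fun x => ?_)).trans (le_trans (le_of_eq ?_) hφu)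
      · rw [norm_mul, norm_sub_rev, Pi.sub_apply]
        exact mul_le_of_le_one_left (norm_nonneg _) (hf1 x)
      · rw [norm_sub_eq_integral]
        refine integral_congr_ae ?_
        filter_upwards [ccL1_ae (lam := lam) u hu hs] with x hx
        rw [hx, Pi.sub_apply]
    simp only [hfu] at h3
    rw [integral_complex_ofReal] at h3
    exact (le_abs_self _).trans (by simpa using h3)
  have hK : IsCompact (tsupport u) := hs
  have hKm : MeasurableSet (tsupport u) := (isClosed_tsupport u).measurableSet
  -- Pointwise `|u| ≤ |u|² / (|u| + δ) + δ`. The last term matters only on the support, of measure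
  -- `M`, and `δ` was chosen so that `M * δ ≤ ε / 3`.
  have h4 : ∫ x, ‖u x‖ ∂lam ≤ ε / 3 + ε / 3 := by
    have hind : Integrable ((tsupport u).indicator fun _ => δ) lam :=
      (integrable_indicator_iff hKm).2 (integrableOn_const hK.measure_ne_top)
    calc ∫ x, ‖u x‖ ∂lam
        ≤ ∫ x, (‖u x‖ ^ 2 / (‖u x‖ + δ) + (tsupport u).indicator (fun _ => δ) x) ∂lam := by
          refine integral_mono hui.norm (hintr.add hind) fun x => ?_
          dsimp only
          by_cases hx : x ∈ tsupport u
          · rw [Set.indicator_of_mem hx, div_add' _ _ _ (hden x).ne', le_div_iff₀ (hden x)]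
            nlinarith [norm_nonneg (u x)]
          · simp [image_eq_zero_of_notMem_tsupport hx, hx]
      _ = ∫ x, ‖u x‖ ^ 2 / (‖u x‖ + δ) ∂lam + M * δ := by
          rw [integral_add hintr hind, integral_indicator_const _ hKm, smul_eq_mul]
      _ ≤ ε / 3 + ε / 3 := by
          gcongr
          rw [hδdef, mul_div_assoc', div_le_iff₀ (by positivity)]
          nlinarith
  have h5 : ‖ccL1 lam u hu hs‖ = ∫ x, ‖u x‖ ∂lam := by
    rw [L1.norm_eq_integral_norm]
    refine integral_congr_ae ?_
    filter_upwards [ccL1_ae (lam := lam) u hu hs] with x hx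
    rw [hx]
  have h6 := norm_add_le (φ - ccL1 lam u hu hs) (ccL1 lam u hu hs)
  rw [sub_add_cancel] at h6
  linarith

theorem ext_of_forall_integral_mul_eq {φ ψ : L1 lam}
    (h : ∀ f : G → ℂ, Continuous f → HasCompactSupport f →
      ∫ x, f x * φ x ∂lam = ∫ x, f x * ψ x ∂lam) : φ = ψ := by
  rw [← sub_eq_zero]
  refine eq_zero_of_forall_integral_mul_eq_zero _ fun f hf hs => ?_
  change pairing (ccZeroAtInfty f hf hs) (φ - ψ) = 0
  rw [map_sub, sub_eq_zero]
  exact h f hf hs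

/-- Compactly supported continuous functions are left uniformly continuous. -/
theorem exists_nhds_one_norm_sub_lt {f : G → ℂ} (hf : Continuous f) (hs : HasCompactSupport f)
    {ε : ℝ} (hε : 0 < ε) : ∃ V ∈ 𝓝 (1 : G), ∀ x y, x⁻¹ * y ∈ V → ‖f x - f y‖ < ε := by
  let _ : UniformSpace G := IsTopologicalGroup.leftUniformSpace G
  have h := hs.uniformContinuous_of_continuous hf
  have h1 := h (Metric.dist_mem_uniformity hε)
  obtain ⟨V, hV, hVs⟩ := Filter.mem_comap.1 (show _ ∈ comap _ _ from h1)
  exact ⟨V, hV, fun x y hxy => by simpa [dist_eq_norm] using hVs (a := (x, y)) hxy⟩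

-- Symmetry under inversion keeps the modular function out of right convolution, so one family
-- serves as approximate identity on both sides.
variable (lam) in
theorem exists_symmetric_bump {U : Set G} (hU : U ∈ 𝓝 (1 : G)) :
    ∃ g : G → ℝ, Continuous g ∧ HasCompactSupport g ∧ (∀ x, 0 ≤ g x) ∧ (∀ x, g x⁻¹ = g x) ∧
      Function.support g ⊆ U ∧ ∫ x, g x ∂lam = 1 := by
  obtain ⟨V, hVU, hVo, hV1⟩ := mem_nhds_iff.1 hU
  obtain ⟨f, hf1, hf0, hfs, hf⟩ := exists_continuous_one_zero_of_isCompact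
    (isCompact_singleton (x := (1 : G))) hVo.isClosed_compl (by simpa using hV1)
  have hfn : ∀ x, 0 ≤ f x := fun x => (hf x).1
  set g : G → ℝ := fun x => f x * f x⁻¹ with hg
  have hgc : Continuous g := f.continuous.mul (f.continuous.comp continuous_inv)
  have hgs : HasCompactSupport g := hfs.mul_right
  have hgn : ∀ x, 0 ≤ g x := fun x => mul_nonneg (hfn _) (hfn _)
  have hpos : 0 < ∫ x, g x ∂lam := by
    refine hgc.integral_pos_of_hasCompactSupport_nonneg_nonzero hgs hgn (x := 1) ?_
    have : f 1 = 1 := hf1 rfl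
    simp [hg, this]
  refine ⟨fun x => g x / ∫ x, g x ∂lam, hgc.div_const _, ?_, fun x => div_nonneg (hgn x) hpos.le,
    fun x => by simp only [hg, inv_inv, mul_comm], fun x hx => hVU ?_, ?_⟩
  · simp only [div_eq_mul_inv]
    exact hgs.mul_right
  · by_contra hxV
    exact hx (by simp [hg, hf0 hxV])
  · rw [integral_div, div_self hpos.ne']

/-- As `g` has integral 1, `g * φ - φ` is the `g`-weighted average of `translate x φ - φ`. -/
theorem norm_conv_sub_le_of_support {g : G → ℂ} (hg : Continuous g) (hs : HasCompactSupport g)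
    (h1 : ∫ x, g x ∂lam = 1) (hn : ∫ x, ‖g x‖ ∂lam = 1) (φ : L1 lam) {ε : ℝ}
    (h : ∀ x ∈ Function.support g, ‖translate x φ - φ‖ ≤ ε) :
    ‖conv (ccL1 lam g hg hs) φ - φ‖ ≤ ε := by
  have hgi : Integrable g lam := hg.integrable_of_hasCompactSupport hs
  have h2 : conv (ccL1 lam g hg hs) φ = ∫ x, g x • translate x φ ∂lam := by
    refine integral_congr_ae ?_
    filter_upwards [ccL1_ae (lam := lam) g hg hs] with x hx
    rw [hx]
  have h3 : φ = ∫ x, g x • φ ∂lam := by rw [integral_smul_const, h1, one_smul]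
  have h4 : conv (ccL1 lam g hg hs) φ - φ = ∫ x, g x • (translate x φ - φ) ∂lam := by
    conv_lhs => rw [h2, h3]
    rw [← integral_sub]
    · conv_rhs => simp only [smul_sub]
      rw [← h3]
    · rw [← h3]
      exact integrable_smul_continuous hgi (continuous_translate φ)
        fun x => (norm_translate x φ).le
    · exact hgi.smul_const _
  rw [h4]
  refine (norm_integral_le_of_norm_le (hgi.norm.mul_const ε)
    (Eventually.of_forall fun x => ?_)).trans_eq (by rw [integral_mul_const, hn, one_mul])
  rw [norm_smul]
  by_cases hx : g x = 0
  · simp [hx]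
  · gcongr
    exact h x hx

/-- The convolution of compactly supported continuous functions is given by the usual integral. -/
theorem conv_ccL1_ae {f g : G → ℂ} (hf : Continuous f) (hfs : HasCompactSupport f)
    (hg : Continuous g) (hgs : HasCompactSupport g) :
    conv (ccL1 lam f hf hfs) (ccL1 lam g hg hgs) =ᵐ[lam] fun y => ∫ x, f x * g (x⁻¹ * y) ∂lam := by
  set F : G → ℂ := fun y => ∫ x, f x * g (x⁻¹ * y) ∂lam with hF
  have hFc : Continuous F := by
    rw [← continuousOn_univ]
    refine continuousOn_integral_of_compact_support (k := tsupport f) hfs ?_ fun y x _ hx => ?_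
    · exact Continuous.continuousOn (by simp only [Function.uncurry_def]; fun_prop)
    · rw [image_eq_zero_of_notMem_tsupport hx, zero_mul]
  have hFs : HasCompactSupport F := by
    refine HasCompactSupport.intro (IsCompact.mul hfs hgs) fun y hy => ?_
    refine integral_eq_zero_of_ae (Eventually.of_forall fun x => ?_)
    by_contra hne
    refine hy ⟨x, subset_tsupport _ (left_ne_zero_of_mul hne), x⁻¹ * y,
      subset_tsupport _ (right_ne_zero_of_mul hne), by simp⟩
  suffices h : conv (ccL1 lam f hf hfs) (ccL1 lam g hg hgs) = ccL1 lam F hFc hFs by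
    rw [h]; exact ccL1_ae F hFc hFs
  refine ext_of_forall_integral_mul_eq fun u hu hus => ?_
  have e1 := integral_mul_conv (ccL1 lam f hf hfs) (ccL1 lam g hg hgs) (ccZeroAtInfty u hu hus)
  change ∫ z, u z * _ ∂lam = ∫ x, (∫ y, u (x * y) * _ ∂lam) * _ ∂lam at e1
  rw [e1]
  calc ∫ x, (∫ y, u (x * y) * ccL1 lam g hg hgs y ∂lam) * ccL1 lam f hf hfs x ∂lam
      = ∫ x, (∫ y, u y * (f x * g (x⁻¹ * y)) ∂lam) ∂lam := by
        refine integral_congr_ae ?_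
        filter_upwards [ccL1_ae (lam := lam) f hf hfs] with x hx
        rw [hx, ← integral_mul_left_eq_self (μ := lam) (fun y => u y * (f x * g (x⁻¹ * y))) x,
          ← integral_mul_const]
        refine integral_congr_ae ?_
        filter_upwards [ccL1_ae (lam := lam) g hg hgs] with y hy
        rw [hy, inv_mul_cancel_left]
        ring
    -- The integrand is continuous with compact support, so the swap needs no σ-finiteness of `lam`.
    _ = ∫ y, (∫ x, u y * (f x * g (x⁻¹ * y)) ∂lam) ∂lam := by
        refine integral_integral_swap_of_hasCompactSupport
          (by simp only [Function.uncurry_def]; fun_prop) ?_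
        refine HasCompactSupport.intro (IsCompact.prod hfs hus) fun p hp => ?_
        simp only [Function.uncurry_def]
        rw [Set.mem_prod, not_and_or] at hp
        rcases hp with hp | hp <;> simp [image_eq_zero_of_notMem_tsupport hp]
    _ = ∫ y, u y * ccL1 lam F hFc hFs y ∂lam := by
        refine integral_congr_ae ?_
        filter_upwards [ccL1_ae (lam := lam) F hFc hFs] with y hy
        rw [hy, integral_const_mul]

/-- The value `(f * g) y` averages `f x` over `x⁻¹ * y` in the support of `g`, so it is within `ε`
of `f y`. Both functions vanish off the compact set `tsupport f * C`, which turns the uniform bound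
into an `L¹` bound. -/
theorem norm_conv_ccL1_sub_le {f : G → ℂ} (hf : Continuous f) (hfs : HasCompactSupport f)
    {g : G → ℝ} (hg : Continuous fun x => (g x : ℂ)) (hgs : HasCompactSupport fun x => (g x : ℂ))
    (hg0 : ∀ x, 0 ≤ g x) (hgi : ∀ x, g x⁻¹ = g x) (h1 : ∫ x, g x ∂lam = 1) {C : Set G}
    (hC : IsCompact C) (hC1 : 1 ∈ C) (hgC : Function.support g ⊆ C) {ε : ℝ}
    (h : ∀ x y, x⁻¹ * y ∈ Function.support g → ‖f x - f y‖ ≤ ε) :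
    ‖conv (ccL1 lam f hf hfs) (ccL1 lam _ hg hgs) - ccL1 lam f hf hfs‖ ≤
      lam.real (tsupport f * C) * ε := by
  have hK : IsCompact (tsupport f * C) := IsCompact.mul hfs hC
  have hKm : MeasurableSet (tsupport f * C) := hK.measurableSet
  have hgr : Continuous g := Complex.continuous_re.comp hg
  have hgsr : HasCompactSupport g := by
    refine hgs.mono fun x hx => ?_
    simpa using hx
  have hind : Integrable ((tsupport f * C).indicator fun _ => ε) lam :=
    (integrable_indicator_iff hKm).2 (integrableOn_const hK.measure_ne_top)
  rw [norm_sub_eq_integral, ← smul_eq_mul, ← integral_indicator_const _ hKm]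
  refine integral_mono_ae ?_ hind ?_
  · exact ((L1.integrable_coeFn _).sub (L1.integrable_coeFn _)).norm
  filter_upwards [conv_ccL1_ae (lam := lam) hf hfs hg hgs, ccL1_ae (lam := lam) f hf hfs]
    with y hy hy'
  rw [hy, hy']
  by_cases hyK : y ∈ tsupport f * C
  · rw [Set.indicator_of_mem hyK]
    have hsupp : HasCompactSupport fun x => g (x⁻¹ * y) :=
      hgsr.comp_homeomorph ((Homeomorph.inv G).trans (Homeomorph.mulRight y))
    have hsuppc : HasCompactSupport fun x => (g (x⁻¹ * y) : ℂ) :=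
      hgs.comp_homeomorph ((Homeomorph.inv G).trans (Homeomorph.mulRight y))
    have hgint : Integrable (fun x => g (x⁻¹ * y)) lam :=
      (hgr.comp (by fun_prop : Continuous fun x : G => x⁻¹ * y)).integrable_of_hasCompactSupport
        hsupp
    have hcc : Continuous fun x => (g (x⁻¹ * y) : ℂ) :=
      hg.comp (by fun_prop : Continuous fun x : G => x⁻¹ * y)
    -- Translating `x` to `y * x` leaves `g x⁻¹`, which is `g x` by symmetry.
    have hgtot : ∫ x, g (x⁻¹ * y) ∂lam = 1 := by
      rw [← integral_mul_left_eq_self (μ := lam) (fun x => g (x⁻¹ * y)) y, ← h1]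
      simp [hgi]
    have hgtotc : ∫ x, (g (x⁻¹ * y) : ℂ) ∂lam = 1 := by
      rw [integral_complex_ofReal, hgtot]; simp
    have e : ∫ x, f x * g (x⁻¹ * y) ∂lam - f y = ∫ x, (f x - f y) * g (x⁻¹ * y) ∂lam := by
      simp only [sub_mul]
      rw [integral_sub, integral_const_mul, hgtotc, mul_one]
      · exact (hf.mul hcc).integrable_of_hasCompactSupport hsuppc.mul_left
      · exact (hcc.integrable_of_hasCompactSupport hsuppc).const_mul _
    rw [e]
    refine (norm_integral_le_of_norm_le (hgint.const_mul ε)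
      (Eventually.of_forall fun x => ?_)).trans_eq (by rw [integral_const_mul, hgtot, mul_one])
    rw [norm_mul, Complex.norm_real, Real.norm_eq_abs, abs_of_nonneg (hg0 _)]
    by_cases hx : g (x⁻¹ * y) = 0
    · simp [hx]
    · gcongr
      · exact hg0 _
      · exact h x y hx
  · rw [Set.indicator_of_notMem hyK]
    have hfy : f y = 0 := by
      by_contra hne
      exact hyK ⟨y, subset_tsupport _ hne, 1, hC1, mul_one y⟩
    have hz : ∀ x, f x * (g (x⁻¹ * y) : ℂ) = 0 := fun x => by
      by_contra hne
      refine hyK ⟨x, subset_tsupport _ (left_ne_zero_of_mul hne), x⁻¹ * y, hgC ?_, by simp⟩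
      simpa using right_ne_zero_of_mul hne
    simp [hfy, hz]

variable (lam) in
/-- `L¹(G)` has a two-sided approximate identity of norm at most one. -/
theorem exists_approximate_identity : ∃ e : OpenNhdsOf (1 : G) → L1 lam,
    (∀ U, ‖e U‖ ≤ 1) ∧ (∀ φ, Tendsto (fun U => conv (e U) φ) atBot (𝓝 φ)) ∧
    ∀ φ, Tendsto (fun U => conv φ (e U)) atBot (𝓝 φ) := by
  choose g hgc hgs hg0 hgi hgU hg1 using
    fun U : OpenNhdsOf (1 : G) => exists_symmetric_bump lam (U.isOpen.mem_nhds U.mem)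
  have hcc : ∀ U, Continuous fun x => (g U x : ℂ) := fun U =>
    Complex.continuous_ofReal.comp (hgc U)
  have hcs : ∀ U, HasCompactSupport fun x => (g U x : ℂ) := fun U =>
    (hgs U).comp_left Complex.ofReal_zero
  have hn : ∀ U, ∫ x, ‖(g U x : ℂ)‖ ∂lam = 1 := fun U => by
    simp only [Complex.norm_real, Real.norm_eq_abs, abs_of_nonneg (hg0 U _), hg1]
  set e : OpenNhdsOf (1 : G) → L1 lam := fun U => ccL1 lam _ (hcc U) (hcs U)
  have hsmall : ∀ V ∈ 𝓝 (1 : G), ∀ᶠ U in atBot, Function.support (g U) ⊆ V := by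
    intro V hV
    obtain ⟨W, hWV, hWo, hW1⟩ := mem_nhds_iff.1 hV
    filter_upwards [eventually_le_atBot (⟨⟨W, hWo⟩, hW1⟩ : OpenNhdsOf (1 : G))] with U hU
    exact (hgU U).trans (Set.Subset.trans hU hWV)
  have hnorm : ∀ U, ‖e U‖ ≤ 1 := fun U => by
    rw [L1.norm_eq_integral_norm, ← hn U]
    refine (integral_congr_ae ?_).le
    filter_upwards [ccL1_ae (lam := lam) _ (hcc U) (hcs U)] with x hx
    rw [hx]
  refine ⟨e, hnorm, ?_, ?_⟩
  · intro φ
    rw [Metric.tendsto_nhds]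
    intro ε hε
    have hV : ∀ᶠ x in 𝓝 (1 : G), ‖translate x φ - φ‖ ≤ ε / 2 := by
      have h1 : translate 1 φ = φ := by simp [translate]
      have h2 := Metric.tendsto_nhds.1 ((continuous_translate φ).tendsto 1) (ε / 2) (half_pos hε)
      filter_upwards [h2] with x hx
      rw [h1, dist_eq_norm] at hx
      exact hx.le
    filter_upwards [hsmall _ hV] with U hU
    rw [dist_eq_norm]
    refine (norm_conv_sub_le_of_support (hcc U) (hcs U) ?_ (hn U) φ fun x hx => hU ?_).trans_lt
      (half_lt_self hε)
    · rw [integral_complex_ofReal, hg1]; simp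
    · simpa using hx
  · intro φ
    rw [Metric.tendsto_nhds]
    intro ε hε
    obtain ⟨f, hf, hfs, hφf⟩ := exists_norm_sub_ccL1_le φ (ε := ε / 4) (by positivity)
    -- Fixing `C` first bounds the supports by a set of measure `M` independent of `U`; only then is
    -- `V` chosen in terms of `M`.
    obtain ⟨C, hC, hC1⟩ := exists_compact_mem_nhds (1 : G)
    set M := lam.real (tsupport f * C)
    have hM : 0 ≤ M := measureReal_nonneg
    obtain ⟨V, hV, hVf⟩ := exists_nhds_one_norm_sub_lt hf hfs
      (ε := ε / 4 / (M + 1)) (by positivity)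
    filter_upwards [hsmall _ hV, hsmall _ hC1] with U hUV hUC
    rw [dist_eq_norm]
    have h1 := norm_conv_ccL1_sub_le (lam := lam) hf hfs (hcc U) (hcs U) (hg0 U) (hgi U) (hg1 U)
      hC (mem_of_mem_nhds hC1) hUC fun x y hxy => (hVf x y (hUV hxy)).le
    have h2 : M * (ε / 4 / (M + 1)) ≤ ε / 4 := by
      rw [mul_div_assoc', div_le_iff₀ (by positivity)]
      nlinarith
    have h3 : ‖conv (φ - ccL1 lam f hf hfs) (e U)‖ ≤ ε / 4 :=
      (norm_conv_le _ _).trans ((mul_le_of_le_one_right (norm_nonneg _) (hnorm U)).trans hφf)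
    have h4 : conv φ (e U) - φ = conv (φ - ccL1 lam f hf hfs) (e U) +
        (conv (ccL1 lam f hf hfs) (e U) - ccL1 lam f hf hfs) - (φ - ccL1 lam f hf hfs) := by
      rw [sub_conv]; abel
    rw [h4]
    refine (norm_sub_le _ _).trans_lt ?_
    have h5 := norm_add_le (conv (φ - ccL1 lam f hf hfs) (e U))
      (conv (ccL1 lam f hf hfs) (e U) - ccL1 lam f hf hfs)
    linarith [h1.trans h2]

end ApproximateIdentity

/-! ### Faithfulness of the action of `M(G)`, and representation of centralizers. -/

section JordanCentralizers

variable {G : Type*} [Group G] [TopologicalSpace G] [IsTopologicalGroup G] [LocallyCompactSpace G]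
  [T2Space G] [MeasurableSpace G] [BorelSpace G]
  {lam : Measure G} [lam.IsHaarMeasure] [lam.Regular]

theorem integral_mul_ccL1 (f g : G → ℂ) (hg : Continuous g) (hgs : HasCompactSupport g) (x : G) :
    ∫ y, f (x * y) * ccL1 lam g hg hgs y ∂lam = ∫ y, f (x * y) * g y ∂lam := by
  refine integral_congr_ae ?_
  filter_upwards [ccL1_ae (lam := lam) g hg hgs] with y hy
  rw [hy]

/-- Strong continuity of translation. With the compact support shown next, this kernel is an
admissible test function for vague convergence. -/
theorem continuous_integral_mul_right {f g : G → ℂ} (hf : Continuous f) (hfs : HasCompactSupport f)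
    (hg : Continuous g) (hgs : HasCompactSupport g) :
    Continuous fun x => ∫ y, f (x * y) * g y ∂lam := by
  have h : Continuous fun x => pairing (ccZeroAtInfty f hf hfs)
      (translate x (ccL1 lam g hg hgs)) :=
    (ContinuousLinearMap.continuous _).comp (continuous_translate _)
  refine h.congr fun x => ?_
  rw [pairing_translate]
  exact integral_mul_ccL1 f g hg hgs x

theorem hasCompactSupport_integral_mul_right {f g : G → ℂ} (hfs : HasCompactSupport f)
    (hgs : HasCompactSupport g) : HasCompactSupport fun x => ∫ y, f (x * y) * g y ∂lam := by
  refine HasCompactSupport.intro (IsCompact.mul hfs (IsCompact.inv hgs)) fun x hx =>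
    integral_eq_zero_of_ae (Eventually.of_forall fun y => ?_)
  by_contra hne
  exact hx ⟨x * y, subset_tsupport _ (left_ne_zero_of_mul hne), y⁻¹,
    Set.inv_mem_inv.2 (subset_tsupport _ (right_ne_zero_of_mul hne)), by simp⟩

theorem pairing_measureConv_ccL1 (μ : MeasureAlgebra G) {f g : G → ℂ} (hf : Continuous f)
    (hfs : HasCompactSupport f) (hg : Continuous g) (hgs : HasCompactSupport g) :
    pairing (ccZeroAtInfty f hf hfs) (measureConv μ (ccL1 lam g hg hgs)) =
      μ.1.integral (fun x => ∫ y, f (x * y) * g y ∂lam) (ContinuousLinearMap.mul ℝ ℂ) := by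
  refine (integral_mul_measureConv μ (ccL1 lam g hg hgs) (ccZeroAtInfty f hf hfs)).trans ?_
  congr 1
  exact funext fun x => integral_mul_ccL1 f g hg hgs x

theorem pairing_conv_ccL1 (φ : L1 lam) {f g : G → ℂ} (hf : Continuous f)
    (hfs : HasCompactSupport f) (hg : Continuous g) (hgs : HasCompactSupport g) :
    pairing (ccZeroAtInfty f hf hfs) (conv φ (ccL1 lam g hg hgs)) =
      ∫ x, (∫ y, f (x * y) * g y ∂lam) * φ x ∂lam := by
  refine (integral_mul_conv φ (ccL1 lam g hg hgs) (ccZeroAtInfty f hf hfs)).trans ?_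
  congr 1
  exact funext fun x => congrArg (· * φ x) (integral_mul_ccL1 f g hg hgs x)

/-- The action of `M(G)` on `L¹(G)` by convolution is faithful. -/
theorem eq_zero_of_forall_measureConv_eq_zero (μ : MeasureAlgebra G)
    (h : ∀ φ : L1 lam, measureConv μ φ = 0) : μ = 0 := by
  refine eq_zero_of_forall_integral_eq_zero μ fun f hf hfs => ?_
  rw [← norm_le_zero_iff]
  refine le_of_forall_pos_le_add fun ε hε => ?_
  have hδ : 0 < ε / (‖μ‖ + 1) := by positivity
  obtain ⟨V, hV, hVf⟩ := exists_nhds_one_norm_sub_lt hf hfs hδ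
  obtain ⟨g, hgc, hgs, hg0, -, hgV, hg1⟩ := exists_symmetric_bump lam hV
  have hcc : Continuous fun x => (g x : ℂ) := Complex.continuous_ofReal.comp hgc
  have hcs : HasCompactSupport fun x => (g x : ℂ) := hgs.comp_left Complex.ofReal_zero
  have hgi : Integrable g lam := hgc.integrable_of_hasCompactSupport hgs
  -- `F` smears `f` by a bump near 1. Its `μ`-integral is a pairing with `μ * g = 0`, while `F` is
  -- uniformly within `ε / (‖μ‖ + 1)` of `f`.
  set F : G → ℂ := fun x => ∫ y, f (x * y) * (g y : ℂ) ∂lam with hF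
  have hF0 : μ.1.integral F (ContinuousLinearMap.mul ℝ ℂ) = 0 := by
    rw [← pairing_measureConv_ccL1 μ hf hfs hcc hcs, h, map_zero]
  have hFi : μ.1.Integrable F := integrable_of_hasCompactSupport μ
    (continuous_integral_mul_right hf hfs hcc hcs) (hasCompactSupport_integral_mul_right hfs hcs)
  have hfi := integrable_of_hasCompactSupport μ hf hfs
  have hfF : ∀ x, ‖f x - F x‖ ≤ ε / (‖μ‖ + 1) := by
    intro x
    have e : f x - F x = ∫ y, (f x - f (x * y)) * (g y : ℂ) ∂lam := by
      have hfx : Continuous fun y => f (x * y) := hf.comp (continuous_const.mul continuous_id)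
      have hfg : Integrable (fun y => f (x * y) * (g y : ℂ)) lam :=
        (hfx.mul hcc).integrable_of_hasCompactSupport hcs.mul_left
      simp only [sub_mul]
      rw [integral_sub ((hcc.integrable_of_hasCompactSupport hcs).const_mul _) hfg,
        integral_const_mul,
        integral_complex_ofReal, hg1, Complex.ofReal_one, mul_one]
    rw [e]
    refine (norm_integral_le_of_norm_le (hgi.const_mul (ε / (‖μ‖ + 1)))
      (Eventually.of_forall fun y => ?_)).trans_eq (by rw [integral_const_mul, hg1, mul_one])
    rw [norm_mul, Complex.norm_real, Real.norm_of_nonneg (hg0 y)]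
    by_cases hy : g y = 0
    · simp [hy]
    · gcongr
      · exact hg0 y
      · exact (hVf x (x * y) (by rw [inv_mul_cancel_left]; exact hgV hy)).le
  have e : μ.1.integral f (ContinuousLinearMap.mul ℝ ℂ) =
      μ.1.integral (fun x => f x - F x) (ContinuousLinearMap.mul ℝ ℂ) := by
    rw [VectorMeasure.integral_fun_sub hfi hFi, hF0, sub_zero]
  rw [e, zero_add]
  refine (VectorMeasure.norm_integral_le_of_norm_le_const (Eventually.of_forall hfF)).trans ?_
  rw [← norm_def]
  calc ε / (‖μ‖ + 1) * ‖ContinuousLinearMap.mul ℝ ℂ‖ * ‖μ‖ ≤ ε / (‖μ‖ + 1) * 1 * ‖μ‖ := by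
        gcongr
        exact ContinuousLinearMap.opNorm_mul_le ℝ ℂ
    _ ≤ ε := by
        rw [mul_one, div_mul_eq_mul_div, div_le_iff₀ (by positivity)]
        nlinarith [norm_nonneg μ]

section Centralizer

variable {α : L1 lam →L[ℂ] L1 lam}

/-- Polarization: expand the Jordan identity at `a + b`. -/
theorem IsJordanLeftCentralizer.map_conv_add_conv {T : L1 lam → L1 lam}
    (hT : IsJordanLeftCentralizer α T) (a b : L1 lam) :
    T (conv a b + conv b a) = conv (T a) (α b) + conv (T b) (α a) := by
  have h := hT.map_sq (a + b)
  simp only [conv_add, add_conv, hT.map_add, hT.map_sq, _root_.map_add] at h ⊢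
  rw [← sub_eq_zero] at h ⊢
  rw [← h]
  abel

/-- A continuous Jordan left centralizer is the strong limit of left convolution operators. -/
theorem IsJordanLeftCentralizer.tendsto_conv {T : L1 lam → L1 lam} (hTc : Continuous T)
    (hT : IsJordanLeftCentralizer α T)
    (hα_mul : ∀ φ ψ, α (conv φ ψ) = conv (α φ) (α ψ)) (hα_surj : Function.Surjective α)
    {ι : Type*} {l : Filter ι} {e : ι → L1 lam} (hl : ∀ φ, Tendsto (fun i => conv (e i) φ) l (𝓝 φ))
    (hr : ∀ φ, Tendsto (fun i => conv φ (e i)) l (𝓝 φ)) (b : L1 lam) :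
    Tendsto (fun i => conv (T (e i)) (α b)) l (𝓝 (T b)) := by
  have h1 : Tendsto (fun i => T (conv (e i) b + conv b (e i))) l (𝓝 (T (b + b))) :=
    (hTc.tendsto _).comp ((hl b).add (hr b))
  -- Surjectivity puts `T b` in the range of `α`, so the images `α (e i)` act as a right approximate
  -- identity on it.
  obtain ⟨c, hc⟩ := hα_surj (T b)
  have h2 : Tendsto (fun i => conv (T b) (α (e i))) l (𝓝 (T b)) := by
    rw [← hc]
    simp only [← hα_mul]
    exact (α.continuous.tendsto _).comp (hr c)
  have h3 := h1.sub h2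
  simpa only [hT.map_conv_add_conv, add_sub_cancel_right, hT.map_add] using h3

theorem IsJordanLeftCentralizer.map_smul {T : L1 lam → L1 lam} (hTc : Continuous T)
    (hT : IsJordanLeftCentralizer α T)
    (hα_mul : ∀ φ ψ, α (conv φ ψ) = conv (α φ) (α ψ)) (hα_surj : Function.Surjective α)
    (c : ℂ) (b : L1 lam) : T (c • b) = c • T b := by
  obtain ⟨e, -, hl, hr⟩ := exists_approximate_identity lam
  refine tendsto_nhds_unique (hT.tendsto_conv hTc hα_mul hα_surj hl hr (c • b)) ?_
  simp only [_root_.map_smul, conv_smul]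
  exact (hT.tendsto_conv hTc hα_mul hα_surj hl hr b).const_smul c

theorem exists_measureAlgebra_of_mem_JL
    (hα_mul : ∀ φ ψ, α (conv φ ψ) = conv (α φ) (α ψ)) (hα_surj : Function.Surjective α)
    {T : L1 lam →L[ℂ] L1 lam} (hT : T ∈ JL α) :
    ∃ μ : MeasureAlgebra G, ‖μ‖ ≤ 4 * ‖T‖ ∧ ∀ b, T b = measureConv μ (α b) := by
  obtain ⟨e, he, hl, hr⟩ := exists_approximate_identity lam
  set U := Ultrafilter.of (atBot : Filter (OpenNhdsOf (1 : G)))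
  have hUl : (U : Filter (OpenNhdsOf (1 : G))) ≤ atBot := Ultrafilter.of_le _
  obtain ⟨μ, hμ, hlim⟩ := exists_measureAlgebra_tendsto (m₀ := lam) U
    (h := fun i => T (e i)) (norm_nonneg T) (fun i => L1.integrable_coeFn _) fun i => by
      rw [← L1.norm_eq_integral_norm]
      exact T.le_of_opNorm_le_of_le le_rfl (he i) |>.trans_eq (mul_one _)
  refine ⟨μ, hμ, ?_⟩
  -- Preimages of dense sets under an open map are dense, so it suffices to compare both operators
  -- where `α b` is continuous with compact support.
  have hopen : IsOpenMap α := α.isOpenMap hα_surj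
  have heq : Set.EqOn T ((measureConvCLM μ).comp α)
      (α ⁻¹' {φ : L1 lam | ∃ f hf hs, φ = ccL1 lam f hf hs}) := by
    rintro b ⟨g, hg, hgs, hb⟩
    refine ext_of_forall_integral_mul_eq fun f hf hfs => ?_
    change pairing (ccZeroAtInfty f hf hfs) (T b) =
      pairing (ccZeroAtInfty f hf hfs) (measureConv μ (α b))
    have h1 := ((ContinuousLinearMap.continuous (pairing (lam := lam)
      (ccZeroAtInfty f hf hfs))).tendsto _).comp
        ((IsJordanLeftCentralizer.tendsto_conv T.continuous hT hα_mul hα_surj hl hr b).mono_left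
          hUl)
    -- The same pairings also converge to the `μ`-side, because `conv` and `measureConv` pair with
    -- `f` through the same kernel.
    refine tendsto_nhds_unique h1 ?_
    rw [hb, pairing_measureConv_ccL1]
    refine (hlim _ (continuous_integral_mul_right (lam := lam) hf hfs hg hgs)
      (hasCompactSupport_integral_mul_right hfs hgs)).congr fun i => ?_
    exact (pairing_conv_ccL1 (T (e i)) hf hfs hg hgs).symm
  have h := Continuous.ext_on (dense_ccL1.preimage hopen) T.continuous
    ((measureConvCLM μ).comp α).continuous heq
  exact fun b => congrFun h b

theorem measureConvCLM_comp_mem_JL (hα_mul : ∀ φ ψ, α (conv φ ψ) = conv (α φ) (α ψ))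
    (μ : MeasureAlgebra G) : (measureConvCLM μ).comp α ∈ JL α :=
  ⟨fun a b => map_add _ a b, fun a => by
    simp only [ContinuousLinearMap.comp_apply, measureConvCLM_apply, hα_mul, measureConv_conv]⟩

/-- The homomorphism `μ ↦ (φ ↦ μ * α φ)` from `M(G)` to the Jordan left `α`-centralizers. -/
def measureToJL (hα_mul : ∀ φ ψ, α (conv φ ψ) = conv (α φ) (α ψ)) : MeasureAlgebra G →+ JL α where
  toFun μ := ⟨(measureConvCLM μ).comp α, measureConvCLM_comp_mem_JL hα_mul μ⟩
  map_zero' := Subtype.ext <| ContinuousLinearMap.ext fun φ => by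
    have h := norm_measureConv_le (0 : MeasureAlgebra G) (α φ)
    rw [norm_zero, zero_mul, norm_le_zero_iff] at h
    exact h
  map_add' μ ν := Subtype.ext <| ContinuousLinearMap.ext fun φ => add_measureConv μ ν (α φ)

theorem norm_measureToJL_le (hα_mul : ∀ φ ψ, α (conv φ ψ) = conv (α φ) (α ψ))
    (μ : MeasureAlgebra G) : ‖measureToJL hα_mul μ‖ ≤ ‖α‖ * ‖μ‖ := by
  change ‖(measureConvCLM (lam := lam) μ).comp α‖ ≤ _
  refine (ContinuousLinearMap.opNorm_comp_le _ _).trans ?_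
  rw [mul_comm]
  gcongr
  exact LinearMap.mkContinuous_norm_le _ (norm_nonneg _) _

theorem bijective_measureToJL (hα_mul : ∀ φ ψ, α (conv φ ψ) = conv (α φ) (α ψ))
    (hα_surj : Function.Surjective α) : Function.Bijective (measureToJL hα_mul) := by
  constructor
  · refine (injective_iff_map_eq_zero _).2 fun μ hμ => ?_
    refine eq_zero_of_forall_measureConv_eq_zero (lam := lam) μ fun φ => ?_
    obtain ⟨b, rfl⟩ := hα_surj φ
    exact congrArg (fun S : JL α => S.1 b) hμ
  · rintro ⟨T, hT⟩
    obtain ⟨μ, -, hμ⟩ := exists_measureAlgebra_of_mem_JL hα_mul hα_surj hT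
    exact ⟨μ, Subtype.ext <| ContinuousLinearMap.ext fun b => (hμ b).symm⟩

/-- The homeomorphism `μ ↦ (φ ↦ μ * α φ)` of `M(G)` onto the Jordan left `α`-centralizers. -/
def measureHomeomorphJL (hα_mul : ∀ φ ψ, α (conv φ ψ) = conv (α φ) (α ψ))
    (hα_surj : Function.Surjective α) : MeasureAlgebra G ≃ₜ JL α where
  toEquiv := (AddEquiv.ofBijective (measureToJL hα_mul)
    (bijective_measureToJL hα_mul hα_surj)).toEquiv
  continuous_toFun :=
    AddMonoidHomClass.continuous_of_bound (measureToJL hα_mul) ‖α‖ (norm_measureToJL_le hα_mul)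
  continuous_invFun :=
    AddMonoidHomClass.continuous_of_bound (AddEquiv.ofBijective (measureToJL hα_mul)
      (bijective_measureToJL hα_mul hα_surj)).symm 4 fun T => by
        obtain ⟨μ, hμT, hμ⟩ := exists_measureAlgebra_of_mem_JL hα_mul hα_surj T.2
        have h : measureToJL hα_mul μ = T :=
          Subtype.ext <| ContinuousLinearMap.ext fun b => (hμ b).symm
        have h2 : (AddEquiv.ofBijective (measureToJL hα_mul)
            (bijective_measureToJL hα_mul hα_surj)).symm T = μ := by
          rw [AddEquiv.symm_apply_eq]
          exact h.symm
        rw [h2]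
        exact hμT

/-- Additivity is automatic for bounded operators; what remains is an equation between continuous
functions of `T` for each `a`. -/
theorem isClosed_JL (α : L1 lam →L[ℂ] L1 lam) : IsClosed (JL α : Set (L1 lam →L[ℂ] L1 lam)) := by
  have h : (JL α : Set (L1 lam →L[ℂ] L1 lam)) =
      ⋂ a, {T : L1 lam →L[ℂ] L1 lam | T (conv a a) = convCLM (T a) (α a)} := by
    ext T
    simp only [Set.mem_iInter, Set.mem_ofPred_eq]
    exact ⟨fun hT a => hT.map_sq a, fun hT => ⟨map_add T, hT⟩⟩
  rw [h]
  refine isClosed_iInter fun a => isClosed_eq (by fun_prop) (by fun_prop)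

end Centralizer

end JordanCentralizers

end GroupAlgebra

end

theorem corollary3p2 {G : Type*} [Group G] [TopologicalSpace G] [IsTopologicalGroup G]
    [LocallyCompactSpace G] [T2Space G] [MeasurableSpace G] [BorelSpace G]
    (lam : Measure G) [lam.IsHaarMeasure] [lam.Regular]
    (α : GroupAlgebra.L1 lam →L[ℂ] GroupAlgebra.L1 lam)
    (hα_mul : ∀ φ ψ, α (GroupAlgebra.conv φ ψ) = GroupAlgebra.conv (α φ) (α ψ))
    (hα_surj : Function.Surjective α) :
    (∃ Γ : GroupAlgebra.MeasureAlgebra G ≃ₜ GroupAlgebra.JL α,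
      ∀ (μ : GroupAlgebra.MeasureAlgebra G) (φ : GroupAlgebra.L1 lam),
        (Γ μ : GroupAlgebra.L1 lam →L[ℂ] GroupAlgebra.L1 lam) φ = GroupAlgebra.Lam μ α φ) ∧
    CompleteSpace (GroupAlgebra.JL α) ∧
    (∀ T : GroupAlgebra.L1 lam → GroupAlgebra.L1 lam, Continuous T →
      GroupAlgebra.IsJordanLeftCentralizer α T → ∃ S ∈ GroupAlgebra.JL α, ⇑S = T) := by
  refine ⟨⟨GroupAlgebra.measureHomeomorphJL hα_mul hα_surj, fun μ φ => rfl⟩,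
    (GroupAlgebra.isClosed_JL α).completeSpace_coe, fun T hTc hT => ?_⟩
  -- Complex homogeneity is not assumed of `T`; it comes from the strong-limit formula.
  exact ⟨⟨⟨⟨T, hT.map_add⟩, hT.map_smul hTc hα_mul hα_surj⟩, hTc⟩, hT, rfl⟩
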